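/- Let $A$ be a $C^*$-algebra, let $X$ be a right Hilbert $C^*$-module over $A$, and let $\mathbb{L}(X)$ denote the $C^*$-algebra of bounded adjointable operators on $X$, with operator norm $\|\cdot\|_\infty$. Let $D : \mathrm{Dom}(D) \to X$ be a selfadjoint and regular unbounded operator, that is, $\mathrm{Dom}(D) \subseteq X$ is a norm-dense $A$-submodule and $D$ is $A$-linear and symmetric, and both $D+i$ and $D-i$ map $\mathrm{Dom}(D)$ onto $X$. Let $\sigma(D) \subseteq \mathbb{R}$ be the set of all $\lambda \in \mathbb{C}$ for which $D - \lambda : \mathrm{Dom}(D) \to X$ is not a bijection; for a bounded continuous function $f : \mathbb{R} \to \mathbb{C}$ write $f(D) := \Psi(f|_{\sigma(D)}) \in \mathbb{L}(X)$, where $\Psi : C_b(\sigma(D)) \to \mathbb{L}(X)$ is the unique unital $*$-homomorphism which sends $t \mapsto (t-i)(t+i)^{-1}$ to the Cayley transform $(D-i)(D+i)^{-1}$. An operator $T \in \mathbb{L}(X)$ is Lipschitz with respect to $D$ if $T(\mathrm{Dom}(D)) \subseteq \mathrm{Dom}(D)$ and the commutator $DT - TD : \mathrm{Dom}(D) \to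 X$ extends to a (necessarily unique) bounded adjointable operator $d(T) : X \to X$. For an $L^1$-function $f$ put $\widehat{f}(p) = \frac{1}{\sqrt{2\pi}} \int_{-\infty}^\infty f(x) e^{-ixp}\, dx$, and let $\|\cdot\|_1$ be the $L^1$-norm on $\mathbb{R}$. Let $f : \mathbb{R} \to \mathbb{C}$ be a bounded continuous $L^1$-function such that $p \cdot \widehat{f}(p)$ is an $L^1$-function. Then, for every Lipschitz operator $T$ with respect to $D$, \[ \big\| [f(D), T] \big\|_\infty \leq \|d(T)\|_\infty \cdot \frac{1}{\sqrt{2\pi}} \cdot \| p \cdot \widehat{f}(p) \|_1 , \] and, for every $\rho > 0$, \[ \big\| [f(D/\rho), T] \big\|_\infty \leq \frac{1}{\rho \sqrt{2\pi}} \cdot \|d(T)\|_\infty \cdot \| p \cdot \widehat{f}(p) \|_1 , \] where $f(D/\rho)$ is obtained from the selfadjoint and regular unbounded operator $\rho^{-1} D$ with domain $\mathrm{Dom}(D)$. -/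

import Mathlib

open scoped BoundedContinuousFunction

noncomputable section

set_option linter.unusedSectionVars false

namespace HilbertModule

/-! Hilbert C⋆-modules are Mathlib's `CStarModule`s, whose inner product satisfies
`⟪x, a • y⟫ = a * ⟪x, y⟫`. A right Hilbert `A`-module is therefore a `CStarModule` over the opposite
C⋆-algebra `Aᵐᵒᵖ`: writing `x a` for `op a • x`, the axiom becomes `⟪x, y a⟫ = ⟪x, y⟫ a`, after
identifying the normed `⋆`-space `Aᵐᵒᵖ` with `A`. The definitions below are given for a general
C⋆-algebra of coefficients and are used with `Aᵐᵒᵖ`. -/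

section Adjointable

variable (A X : Type*) [NonUnitalCStarAlgebra A] [PartialOrder A] [StarOrderedRing A]
  [NormedAddCommGroup X] [NormedSpace ℂ X] [SMul A X] [CStarModule A X]

/-- The bounded operators on `X` which admit an adjoint with respect to the `A`-valued inner
product, as a subalgebra of all bounded operators (such operators are automatically `A`-linear). -/
def adjointableSubalgebra : Subalgebra ℂ (X →L[ℂ] X) where
  carrier := {T | ∃ S : X →L[ℂ] X, ∀ x y, inner A (T x) y = inner A x (S y)}
  mul_mem' := by
    rintro T T' ⟨S, hS⟩ ⟨S', hS'⟩
    exact ⟨S' * S, fun x y => by simp [hS, hS']⟩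
  add_mem' := by
    rintro T T' ⟨S, hS⟩ ⟨S', hS'⟩
    exact ⟨S + S', fun x y => by simp [hS, hS']⟩
  algebraMap_mem' := fun c => ⟨algebraMap ℂ _ (star c), fun x y => by
    simp [Algebra.algebraMap_eq_smul_one]⟩

/-- The C⋆-algebra `𝓛(X)` of bounded adjointable operators on `X`, with the operator norm. -/
def Adjointable : Type _ := adjointableSubalgebra A X

instance : NormedRing (Adjointable A X) := inferInstanceAs (NormedRing (adjointableSubalgebra A X))

instance : NormedAlgebra ℂ (Adjointable A X) :=
  inferInstanceAs (NormedAlgebra ℂ (adjointableSubalgebra A X))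

variable {A X}

namespace Adjointable

/-- The underlying bounded operator. -/
def toCLM : Adjointable A X →ₐ[ℂ] (X →L[ℂ] X) := (adjointableSubalgebra A X).val

instance : CoeFun (Adjointable A X) fun _ => X → X := ⟨fun T => toCLM T⟩

theorem norm_def (T : Adjointable A X) : ‖T‖ = ‖toCLM T‖ := rfl

theorem le_opNorm (T : Adjointable A X) (x : X) : ‖T x‖ ≤ ‖T‖ * ‖x‖ :=
  ContinuousLinearMap.le_opNorm (toCLM T) x

@[ext] theorem ext {S T : Adjointable A X} (h : ∀ x, S x = T x) : S = T :=
  Subtype.ext (ContinuousLinearMap.ext h)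

/-- Construct an adjointable operator from a pair of mutually adjoint bounded operators. -/
def mk (T S : X →L[ℂ] X) (h : ∀ x y, inner A (T x) y = inner A x (S y)) : Adjointable A X :=
  ⟨T, S, h⟩

@[simp] theorem mk_apply (T S : X →L[ℂ] X) (h : ∀ x y, inner A (T x) y = inner A x (S y)) (x : X) :
    mk T S h x = T x := rfl

@[simp] theorem mul_apply (S T : Adjointable A X) (x : X) : (S * T) x = S (T x) := rfl
@[simp] theorem one_apply (x : X) : (1 : Adjointable A X) x = x := rfl
@[simp] theorem add_apply (S T : Adjointable A X) (x : X) : (S + T) x = S x + T x := rfl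
@[simp] theorem sub_apply (S T : Adjointable A X) (x : X) : (S - T) x = S x - T x := rfl
@[simp] theorem smul_apply (c : ℂ) (T : Adjointable A X) (x : X) : (c • T) x = c • T x := rfl

end Adjointable

open Adjointable

theorem inner_ext {x x' : X} (h : ∀ y, inner A y x = inner A y x') : x = x' := by
  have h1 : inner A (x - x') (x - x') = (0 : A) := by
    rw [CStarModule.inner_sub_right, h, sub_self]
  exact sub_eq_zero.1 (CStarModule.inner_self.1 h1)

theorem adjoint_unique {T S S' : X →L[ℂ] X} (h : ∀ x y, inner A (T x) y = inner A x (S y))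
    (h' : ∀ x y, inner A (T x) y = inner A x (S' y)) : S = S' :=
  ContinuousLinearMap.ext fun y => inner_ext (A := A) fun x => by rw [← h, h']

/-- The adjoint operator. -/
instance : Star (Adjointable A X) where
  star T := mk T.2.choose T.1 fun x y => by
    rw [← CStarModule.star_inner, ← T.2.choose_spec, CStarModule.star_inner]

theorem inner_apply_left (T : Adjointable A X) (x y : X) :
    inner A (T x) y = inner A x (star T y) := T.2.choose_spec x y

theorem inner_apply_right (T : Adjointable A X) (x y : X) :
    inner A x (T y) = inner A (star T x) y := by
  rw [← CStarModule.star_inner, inner_apply_left, CStarModule.star_inner]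

theorem star_eq_of {T S : Adjointable A X} (h : ∀ x y, inner A (T x) y = inner A x (S y)) :
    star T = S := Subtype.ext (adjoint_unique (A := A) (inner_apply_left T) h)

instance : StarRing (Adjointable A X) where
  star_involutive T := star_eq_of fun x y => (inner_apply_right T x y).symm
  star_mul S T := star_eq_of fun x y => by simp only [mul_apply, inner_apply_left]
  star_add S T := star_eq_of fun x y => by
    rw [Adjointable.add_apply, CStarModule.inner_add_left, inner_apply_left, inner_apply_left,
      Adjointable.add_apply, CStarModule.inner_add_right]

instance : StarModule ℂ (Adjointable A X) where
  star_smul c T := star_eq_of fun x y => by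
    rw [Adjointable.smul_apply, CStarModule.inner_smul_left_complex, inner_apply_left,
      Adjointable.smul_apply, CStarModule.inner_smul_right_complex]

instance : CStarRing (Adjointable A X) where
  norm_mul_self_le T := by
    have h : ‖T‖ ≤ √‖star T * T‖ := by
      refine ContinuousLinearMap.opNorm_le_bound _ (Real.sqrt_nonneg _) fun x => ?_
      refine abs_le_of_sq_le_sq' ?_ (by positivity) |>.2
      rw [mul_pow, Real.sq_sqrt (norm_nonneg _)]
      change ‖T x‖ ^ 2 ≤ _
      rw [CStarModule.norm_sq_eq A, inner_apply_left]
      calc _ ≤ ‖x‖ * ‖(star T * T) x‖ := CStarModule.norm_inner_le X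
        _ ≤ ‖x‖ * (‖star T * T‖ * ‖x‖) := by gcongr; exact le_opNorm _ _
        _ = _ := by ring
    calc _ ≤ √‖star T * T‖ * √‖star T * T‖ := mul_le_mul h h (norm_nonneg _) (Real.sqrt_nonneg _)
      _ = _ := Real.mul_self_sqrt (norm_nonneg _)

variable [CompleteSpace X]

theorem isClosed_adjointableSubalgebra :
    IsClosed (adjointableSubalgebra A X : Set (X →L[ℂ] X)) := by
  refine isClosed_of_closure_subset fun T hT => ?_
  obtain ⟨u, hu, hlim⟩ := mem_closure_iff_seq_limit.1 hT
  let v : ℕ → Adjointable A X := fun n => ⟨u n, hu n⟩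
  have hv : ∀ ε > 0, ∃ N, ∀ m ≥ N, ∀ n ≥ N, dist (u m) (u n) < ε :=
    Metric.cauchySeq_iff.1 hlim.cauchySeq
  have hw : CauchySeq fun n => toCLM (star (v n)) := by
    rw [Metric.cauchySeq_iff]
    intro ε hε
    obtain ⟨N, hN⟩ := hv ε hε
    refine ⟨N, fun m hm n hn => ?_⟩
    have e : ‖star (v m) - star (v n)‖ = ‖v m - v n‖ := by rw [← star_sub, norm_star]
    have := hN m hm n hn
    rw [dist_eq_norm] at this ⊢
    exact lt_of_eq_of_lt e this
  obtain ⟨S, hS⟩ := cauchySeq_tendsto_of_complete hw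
  refine ⟨S, fun x y => ?_⟩
  have e1 : Filter.Tendsto (fun n => u n x) Filter.atTop (nhds (T x)) :=
    ((ContinuousLinearMap.apply ℂ X x).continuous.tendsto T).comp hlim
  have e2 : Filter.Tendsto (fun n => star (v n) y) Filter.atTop (nhds (S y)) :=
    ((ContinuousLinearMap.apply ℂ X y).continuous.tendsto S).comp hS
  have c : Continuous fun p : X × X => inner A p.1 p.2 := CStarModule.continuous_inner
  have l1 := (c.tendsto (T x, y)).comp (e1.prodMk_nhds tendsto_const_nhds)
  have l2 := (c.tendsto (x, S y)).comp (tendsto_const_nhds.prodMk_nhds e2)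
  refine tendsto_nhds_unique l1 (l2.congr fun n => ?_)
  exact (inner_apply_left (v n) x y).symm

instance : CompleteSpace (Adjointable A X) :=
  (isClosed_adjointableSubalgebra (A := A) (X := X)).completeSpace_coe

instance : CStarAlgebra (Adjointable A X) where

end Adjointable

section Unbounded

variable {A X : Type*} [NonUnitalCStarAlgebra A] [PartialOrder A] [StarOrderedRing A]
  [NormedAddCommGroup X] [NormedSpace ℂ X] [SMul A X] [CStarModule A X]

open Complex (I)

/-- The linear map `D - z : Dom(D) → X`. -/
def shift (D : X →ₗ.[ℂ] X) (z : ℂ) : D.domain →ₗ[ℂ] X := D.toFun - z • D.domain.subtype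

theorem shift_apply (D : X →ₗ.[ℂ] X) (z : ℂ) (x : D.domain) :
    shift D z x = D x - z • (x : X) := rfl

variable (A) in
/-- `D` is a selfadjoint and regular unbounded operator on the Hilbert `A`-module `X`: an `A`-linear
symmetric operator, defined on a norm-dense `A`-submodule, such that `D + i` and `D - i` map
`Dom(D)` onto `X`. -/
structure IsSelfadjointRegular (D : X →ₗ.[ℂ] X) : Prop where
  dense_domain : Dense (D.domain : Set X)
  smul_mem : ∀ (a : A) (x : D.domain), a • (x : X) ∈ D.domain
  map_smul : ∀ (a : A) (x : D.domain), D ⟨a • (x : X), smul_mem a x⟩ = a • D x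
  symmetric : ∀ x y : D.domain, inner A (D x) (y : X) = inner A (x : X) (D y)
  surjective_add_I : Function.Surjective fun x : D.domain => D x + I • (x : X)
  surjective_sub_I : Function.Surjective fun x : D.domain => D x - I • (x : X)

/-- The spectrum of `D`: all `z ∈ ℂ` for which `D - z : Dom(D) → X` fails to be a bijection. -/
def spec (D : X →ₗ.[ℂ] X) : Set ℂ := {z | ¬ Function.Bijective (shift D z)}

/-- `(D - z)⁻¹ : X → Dom(D)`. -/
def inverse {D : X →ₗ.[ℂ] X} {z : ℂ} (h : Function.Bijective (shift D z)) : X →ₗ[ℂ] D.domain :=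
  (LinearEquiv.ofBijective (shift D z) h).symm.toLinearMap

theorem shift_inverse {D : X →ₗ.[ℂ] X} {z : ℂ} (h : Function.Bijective (shift D z)) (y : X) :
    shift D z (inverse h y) = y := (LinearEquiv.ofBijective (shift D z) h).apply_symm_apply y

theorem inverse_shift {D : X →ₗ.[ℂ] X} {z : ℂ} (h : Function.Bijective (shift D z))
    (x : D.domain) : inverse h (shift D z x) = x :=
  (LinearEquiv.ofBijective (shift D z) h).symm_apply_apply x

namespace IsSelfadjointRegular

variable {D : X →ₗ.[ℂ] X}

theorem inner_shift_I (hD : IsSelfadjointRegular A D) (x y : D.domain) :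
    inner A (shift D I x) (shift D I y) = inner A (D x) (D y) + inner A (x : X) (y : X) := by
  simp only [shift_apply, CStarModule.inner_sub_left, CStarModule.inner_sub_right,
    CStarModule.inner_smul_left_complex, CStarModule.inner_smul_right_complex,
    hD.symmetric, smul_sub, smul_smul]
  simp
  abel

theorem inner_shift_neg_I (hD : IsSelfadjointRegular A D) (x y : D.domain) :
    inner A (shift D (-I) x) (shift D (-I) y) = inner A (D x) (D y) + inner A (x : X) (y : X) := by
  simp only [shift_apply, CStarModule.inner_sub_left, CStarModule.inner_sub_right,
    CStarModule.inner_smul_left_complex, CStarModule.inner_smul_right_complex,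
    hD.symmetric, smul_sub, smul_smul]
  simp
  abel

theorem norm_shift_eq (hD : IsSelfadjointRegular A D) (x : D.domain) :
    ‖shift D I x‖ = ‖shift D (-I) x‖ := by
  rw [CStarModule.norm_eq_sqrt_norm_inner_self (A := A) (shift D I x),
    CStarModule.norm_eq_sqrt_norm_inner_self (A := A) (shift D (-I) x),
    hD.inner_shift_I, hD.inner_shift_neg_I]

theorem norm_le_shift (hD : IsSelfadjointRegular A D) (x : D.domain) :
    ‖(x : X)‖ ≤ ‖shift D (-I) x‖ := by
  rw [CStarModule.norm_eq_sqrt_norm_inner_self (A := A) (x : X),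
    CStarModule.norm_eq_sqrt_norm_inner_self (A := A) (shift D (-I) x),
    hD.inner_shift_neg_I]
  refine Real.sqrt_le_sqrt (CStarAlgebra.norm_le_norm_of_nonneg_of_le
    CStarModule.inner_self_nonneg ?_)
  exact le_add_of_nonneg_left CStarModule.inner_self_nonneg

theorem bijective_neg_I (hD : IsSelfadjointRegular A D) : Function.Bijective (shift D (-I)) := by
  refine ⟨(injective_iff_map_eq_zero _).2 fun x hx => ?_, fun y => ?_⟩
  · have := hD.norm_le_shift x
    rw [hx, norm_zero] at this
    exact Subtype.ext (norm_le_zero_iff.1 this)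
  · obtain ⟨x, hx⟩ := hD.surjective_add_I y
    exact ⟨x, by simpa [shift_apply] using hx⟩

theorem bijective_I (hD : IsSelfadjointRegular A D) : Function.Bijective (shift D I) := by
  refine ⟨(injective_iff_map_eq_zero _).2 fun x hx => ?_, fun y => ?_⟩
  · have := hD.norm_le_shift x
    rw [← hD.norm_shift_eq, hx, norm_zero] at this
    exact Subtype.ext (norm_le_zero_iff.1 this)
  · obtain ⟨x, hx⟩ := hD.surjective_sub_I y
    exact ⟨x, by simpa [shift_apply] using hx⟩

/-- `(D - i)(D + i)⁻¹` as a bounded operator. -/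
def cayleyCLM (hD : IsSelfadjointRegular A D) : X →L[ℂ] X :=
  (shift D I ∘ₗ inverse hD.bijective_neg_I).mkContinuous 1 fun y => by
    rw [LinearMap.comp_apply, hD.norm_shift_eq, shift_inverse, one_mul]

/-- `(D + i)(D - i)⁻¹` as a bounded operator. -/
def cayleyInvCLM (hD : IsSelfadjointRegular A D) : X →L[ℂ] X :=
  (shift D (-I) ∘ₗ inverse hD.bijective_I).mkContinuous 1 fun y => by
    rw [LinearMap.comp_apply, ← hD.norm_shift_eq, shift_inverse, one_mul]

theorem inner_cayleyCLM (hD : IsSelfadjointRegular A D) (x y : X) :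
    inner A (hD.cayleyCLM x) y = inner A x (hD.cayleyInvCLM y) := by
  change inner A (shift D I (inverse hD.bijective_neg_I x)) y
    = inner A x (shift D (-I) (inverse hD.bijective_I y))
  obtain ⟨u, rfl⟩ := hD.bijective_neg_I.2 x
  obtain ⟨v, rfl⟩ := hD.bijective_I.2 y
  rw [inverse_shift, inverse_shift, hD.inner_shift_I, hD.inner_shift_neg_I]

/-- The Cayley transform `C_D = (D - i)(D + i)⁻¹` of `D`. -/
def cayley (hD : IsSelfadjointRegular A D) : Adjointable A X :=
  Adjointable.mk hD.cayleyCLM hD.cayleyInvCLM hD.inner_cayleyCLM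

theorem cayley_shift (hD : IsSelfadjointRegular A D) (x : D.domain) :
    hD.cayley (shift D (-I) x) = shift D I x := by
  change shift D I (inverse hD.bijective_neg_I _) = _
  rw [inverse_shift]

theorem star_cayley_shift (hD : IsSelfadjointRegular A D) (x : D.domain) :
    (star hD.cayley) (shift D I x) = shift D (-I) x := by
  have : star hD.cayley = Adjointable.mk hD.cayleyInvCLM hD.cayleyCLM fun x y => by
      rw [← CStarModule.star_inner, ← hD.inner_cayleyCLM, CStarModule.star_inner] :=
    star_eq_of hD.inner_cayleyCLM
  rw [this]
  change shift D (-I) (inverse hD.bijective_I _) = _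
  rw [inverse_shift]

theorem cayley_mem_unitary (hD : IsSelfadjointRegular A D) :
    hD.cayley ∈ unitary (Adjointable A X) := by
  refine ⟨Adjointable.ext fun y => ?_, Adjointable.ext fun y => ?_⟩
  · obtain ⟨x, rfl⟩ := hD.bijective_neg_I.2 y
    rw [Adjointable.mul_apply, cayley_shift, star_cayley_shift, Adjointable.one_apply]
  · obtain ⟨x, rfl⟩ := hD.bijective_I.2 y
    rw [Adjointable.mul_apply, star_cayley_shift, cayley_shift, Adjointable.one_apply]

theorem isStarNormal_cayley (hD : IsSelfadjointRegular A D) : IsStarNormal hD.cayley :=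
  ⟨by rw [Commute, SemiconjBy, hD.cayley_mem_unitary.1, hD.cayley_mem_unitary.2]⟩

/-- The resolvent `(D + i)⁻¹ = (1 - C_D) / (2i)`. -/
def res (hD : IsSelfadjointRegular A D) : Adjointable A X := (1 / (2 * I)) • (1 - hD.cayley)

theorem res_shift (hD : IsSelfadjointRegular A D) (x : D.domain) :
    hD.res (shift D (-I) x) = x := by
  rw [res, Adjointable.smul_apply, Adjointable.sub_apply, Adjointable.one_apply,
    cayley_shift, shift_apply, shift_apply]
  have : D x - (-I) • (x : X) - (D x - I • (x : X)) = (2 * I) • (x : X) := by module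
  rw [this, smul_smul, one_div_mul_cancel (by simp), one_smul]

theorem denseRange_res (hD : IsSelfadjointRegular A D) : DenseRange hD.res :=
  hD.dense_domain.mono fun x hx => ⟨shift D (-I) ⟨x, hx⟩, hD.res_shift ⟨x, hx⟩⟩

theorem shift_eq (hD : IsSelfadjointRegular A D) {z : ℂ} (hz : z + I ≠ 0) (x : D.domain) :
    shift D z x = (-(z + I) / (2 * I)) •
      (algebraMap ℂ (Adjointable A X) ((z - I) / (z + I)) - hD.cayley) (shift D (-I) x) := by
  rw [Algebra.algebraMap_eq_smul_one, Adjointable.sub_apply, Adjointable.smul_apply,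
    Adjointable.one_apply, cayley_shift, shift_apply, shift_apply, shift_apply]
  simp only [smul_sub, smul_smul]
  have e1 : -(z + I) / (2 * I) * ((z - I) / (z + I)) = (-(z - I)) / (2 * I) := by field_simp
  rw [e1]
  have hI := Complex.I_ne_zero
  match_scalars
  · field_simp; ring
  · field_simp; ring

theorem isUnit_of_bijective [CompleteSpace X] (T : Adjointable A X) (h : Function.Bijective T)
    (h' : Function.Bijective (star T : Adjointable A X)) : IsUnit T := by
  let e := ContinuousLinearEquiv.ofBijective (Adjointable.toCLM T)
    (LinearMap.ker_eq_bot.2 h.1) (LinearMap.range_eq_top.2 h.2)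
  let e' := ContinuousLinearEquiv.ofBijective (Adjointable.toCLM (star T))
    (LinearMap.ker_eq_bot.2 h'.1) (LinearMap.range_eq_top.2 h'.2)
  have he : ∀ y, T (e.symm y) = y := fun y => e.apply_symm_apply y
  have he2 : ∀ y, e.symm (T y) = y := fun y => e.symm_apply_apply y
  have he' : ∀ y, star T (e'.symm y) = y := fun y => e'.apply_symm_apply y
  let S : Adjointable A X := Adjointable.mk (e.symm : X →L[ℂ] X) (e'.symm : X →L[ℂ] X)
    fun x y => by
      change inner A (e.symm x) y = inner A x (e'.symm y)
      conv_lhs => rw [← he' y, ← inner_apply_left, he]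
  exact ⟨⟨T, S, Adjointable.ext he, Adjointable.ext he2⟩, rfl⟩

theorem bijective_of_isUnit {T : Adjointable A X} (h : IsUnit T) : Function.Bijective T := by
  obtain ⟨u, rfl⟩ := h
  refine Function.bijective_iff_has_inverse.2 ⟨(u⁻¹.1 : Adjointable A X), fun x => ?_, fun x => ?_⟩
  · rw [← Adjointable.mul_apply, u.inv_mul, Adjointable.one_apply]
  · rw [← Adjointable.mul_apply, u.mul_inv, Adjointable.one_apply]

theorem neg_I_notMem_spec (hD : IsSelfadjointRegular A D) : -I ∉ spec D :=
  fun h => h hD.bijective_neg_I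

theorem add_I_ne_zero (hD : IsSelfadjointRegular A D) {z : ℂ} (hz : z ∈ spec D) : z + I ≠ 0 :=
  fun h => hD.neg_I_notMem_spec (by rwa [← eq_neg_of_add_eq_zero_left h])

variable [CompleteSpace X]

theorem bijective_shift_iff (hD : IsSelfadjointRegular A D) {z : ℂ} (hz : z + I ≠ 0) :
    Function.Bijective (shift D z) ↔ Function.Bijective
      (algebraMap ℂ (Adjointable A X) ((z - I) / (z + I)) - hD.cayley) := by
  have hc : -(z + I) / (2 * I) ≠ 0 := div_ne_zero (neg_ne_zero.2 hz) (by simp)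
  have : (shift D z : D.domain → X) = (fun y : X => (-(z + I) / (2 * I)) • y) ∘
      (algebraMap ℂ (Adjointable A X) ((z - I) / (z + I)) - hD.cayley) ∘ shift D (-I) :=
    funext fun x => hD.shift_eq hz x
  rw [this, (MulAction.bijective₀ hc).of_comp_iff', Function.Bijective.of_comp_iff _
    hD.bijective_neg_I]

theorem cayley_mem_spectrum (hD : IsSelfadjointRegular A D) {z : ℂ} (hz : z ∈ spec D) :
    (z - I) / (z + I) ∈ spectrum ℂ hD.cayley := by
  intro h
  exact hz ((hD.bijective_shift_iff (hD.add_I_ne_zero hz)).2 (bijective_of_isUnit h))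

theorem norm_eq_one_of_mem (hD : IsSelfadjointRegular A D) {w : ℂ}
    (hw : w ∈ spectrum ℂ hD.cayley) : ‖w‖ = 1 := by
  simpa using spectrum.subset_circle_of_unitary hD.cayley_mem_unitary hw

theorem im_eq_zero (hD : IsSelfadjointRegular A D) {z : ℂ} (hz : z ∈ spec D) : z.im = 0 := by
  have h := hD.norm_eq_one_of_mem (hD.cayley_mem_spectrum hz)
  rw [norm_div, div_eq_one_iff_eq (norm_ne_zero_iff.2 (hD.add_I_ne_zero hz))] at h
  have h2 : Complex.normSq (z - I) = Complex.normSq (z + I) := by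
    rw [Complex.normSq_eq_norm_sq, Complex.normSq_eq_norm_sq, h]
  simp [Complex.normSq_apply] at h2
  linarith

theorem mem_spec_of_mem_spectrum (hD : IsSelfadjointRegular A D) {w : ℂ}
    (hw : w ∈ spectrum ℂ hD.cayley) (hw1 : w ≠ 1) : I * (1 + w) / (1 - w) ∈ spec D := by
  have h1 : 1 - w ≠ 0 := sub_ne_zero.2 hw1.symm
  have e1 : I * (1 + w) / (1 - w) + I = 2 * I / (1 - w) := by field_simp; ring
  have e2 : I * (1 + w) / (1 - w) - I = 2 * I * w / (1 - w) := by field_simp; ring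
  have h0 : I * (1 + w) / (1 - w) + I ≠ 0 := by
    rw [e1]; exact div_ne_zero (by simp) h1
  intro h
  rw [hD.bijective_shift_iff h0, e1, e2] at h
  have e3 : 2 * I * w / (1 - w) / (2 * I / (1 - w)) = w := by
    have := Complex.I_ne_zero
    field_simp
  rw [e3] at h
  refine hw (isUnit_of_bijective _ h ?_)
  have hww : star w * w = 1 := by
    have := Complex.conj_mul' w
    rw [hD.norm_eq_one_of_mem hw] at this
    simpa using this
  have e4 : star (algebraMap ℂ (Adjointable A X) w - hD.cayley)
      = (-star w) • (star hD.cayley * (algebraMap ℂ (Adjointable A X) w - hD.cayley)) := by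
    rw [star_sub, mul_sub, hD.cayley_mem_unitary.1, Algebra.algebraMap_eq_smul_one, star_smul,
      star_one, mul_smul_comm, mul_one, smul_sub, smul_smul, neg_mul, hww]
    module
  have hs : Function.Bijective (star hD.cayley : Adjointable A X) :=
    bijective_of_isUnit ⟨⟨star hD.cayley, hD.cayley, hD.cayley_mem_unitary.1,
      hD.cayley_mem_unitary.2⟩, rfl⟩
  have hw0 : -star w ≠ 0 := by
    refine neg_ne_zero.2 fun h0 => ?_
    rw [h0, zero_mul] at hww
    exact zero_ne_one hww
  rw [e4]
  exact (MulAction.bijective₀ hw0).comp (hs.comp h)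

/-- The homeomorphism `z ↦ (z - i) / (z + i)`, from `σ(D)` to `σ(C_D) \ {1}`. -/
def specMap (hD : IsSelfadjointRegular A D) : C(spec D, spectrum ℂ hD.cayley) where
  toFun z := ⟨(z - I) / (z + I), hD.cayley_mem_spectrum z.2⟩
  continuous_toFun := by
    refine Continuous.subtype_mk (Continuous.div (by fun_prop) (by fun_prop) fun z => ?_) _
    exact hD.add_I_ne_zero z.2

/-- The function `t ↦ (t - i)(t + i)⁻¹` in `C_b(σ(D))`. -/
def cayleyFun (hD : IsSelfadjointRegular A D) : spec D →ᵇ ℂ :=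
  BoundedContinuousFunction.ofNormedAddCommGroup (fun t => ((t : ℂ) - I) * ((t : ℂ) + I)⁻¹)
    (continuous_subtype_val.comp (hD.specMap.continuous)) 1
    fun t => (hD.norm_eq_one_of_mem (hD.cayley_mem_spectrum t.2)).le

theorem cases_spectrum (hD : IsSelfadjointRegular A D) (w : spectrum ℂ hD.cayley) :
    (w : ℂ) = 1 ∨ ∃ z, hD.specMap z = w := by
  by_cases hw1 : (w : ℂ) = 1
  · exact Or.inl hw1
  · refine Or.inr ⟨⟨_, hD.mem_spec_of_mem_spectrum w.2 hw1⟩, Subtype.ext ?_⟩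
    have h1 : 1 - (w : ℂ) ≠ 0 := sub_ne_zero.2 (Ne.symm hw1)
    have e1 : I * (1 + (w : ℂ)) / (1 - w) + I = 2 * I / (1 - w) := by field_simp; ring
    have e2 : I * (1 + (w : ℂ)) / (1 - w) - I = 2 * I * w / (1 - w) := by field_simp; ring
    change (I * (1 + (w : ℂ)) / (1 - w) - I) / (I * (1 + (w : ℂ)) / (1 - w) + I) = _
    rw [e1, e2]
    have := Complex.I_ne_zero
    field_simp

open Classical in
/-- The function on `σ(C_D)` which corresponds to `t ↦ f(t) (t + i)⁻¹`. -/
def liftFun (hD : IsSelfadjointRegular A D) (f : spec D →ᵇ ℂ) (w : spectrum ℂ hD.cayley) : ℂ :=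
  if h : (w : ℂ) ≠ 1 then
    f ⟨_, hD.mem_spec_of_mem_spectrum w.2 h⟩ * ((1 - (w : ℂ)) / (2 * I)) else 0

theorem continuous_liftFun (hD : IsSelfadjointRegular A D) (f : spec D →ᵇ ℂ) :
    Continuous (hD.liftFun f) := by
  have hbd : ∀ w, ‖hD.liftFun f w‖ ≤ ‖f‖ * (‖1 - (w : ℂ)‖ / 2) := by
    intro w
    unfold liftFun
    split_ifs with h
    · rw [norm_mul, norm_div]
      gcongr
      · exact f.norm_coe_le_norm _
      · simp
    · rw [norm_zero]; positivity
  let U : Set (spectrum ℂ hD.cayley) := {w | (w : ℂ) ≠ 1}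
  have hU : IsOpen U := isOpen_ne_fun continuous_subtype_val continuous_const
  have hc : ContinuousOn (hD.liftFun f) U := by
    rw [continuousOn_iff_continuous_domRestrict]
    have : U.domRestrict (hD.liftFun f) = fun w : U =>
        f ⟨_, hD.mem_spec_of_mem_spectrum w.1.2 w.2⟩ * ((1 - (w.1 : ℂ)) / (2 * I)) :=
      funext fun w => dif_pos w.2
    rw [this]
    refine Continuous.mul (f.continuous.comp (Continuous.subtype_mk ?_ _)) (by fun_prop)
    exact Continuous.div (by fun_prop) (by fun_prop) fun w => sub_ne_zero.2 (Ne.symm w.2)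
  rw [continuous_iff_continuousAt]
  intro w
  by_cases hw : (w : ℂ) = 1
  · have h0 : hD.liftFun f w = 0 := dif_neg (not_not.2 hw)
    rw [ContinuousAt, h0]
    refine squeeze_zero_norm hbd ?_
    have : Continuous fun w : spectrum ℂ hD.cayley => ‖f‖ * (‖1 - (w : ℂ)‖ / 2) := by fun_prop
    have h := this.tendsto w
    simpa [hw] using h
  · exact hc.continuousAt (hU.mem_nhds hw)

/-- `liftFun` as a continuous function. -/
def lift (hD : IsSelfadjointRegular A D) (f : spec D →ᵇ ℂ) : C(spectrum ℂ hD.cayley, ℂ) :=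
  ⟨hD.liftFun f, hD.continuous_liftFun f⟩

theorem lift_eq_zero (hD : IsSelfadjointRegular A D) (f : spec D →ᵇ ℂ)
    {w : spectrum ℂ hD.cayley} (hw : (w : ℂ) = 1) : hD.lift f w = 0 :=
  dif_neg (not_not.2 hw)

theorem lift_specMap (hD : IsSelfadjointRegular A D) (f : spec D →ᵇ ℂ) (z : spec D) :
    hD.lift f (hD.specMap z) = f z * ((z : ℂ) + I)⁻¹ := by
  have h0 := hD.add_I_ne_zero z.2
  have hI := Complex.I_ne_zero
  have e : 1 - ((z : ℂ) - I) / (z + I) = 2 * I / (z + I) := by field_simp; ring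
  have h : ((hD.specMap z : ℂ)) ≠ 1 := by
    intro h
    have h2 : ((z : ℂ) - I) / (z + I) = 1 := h
    rw [h2, sub_self] at e
    exact div_ne_zero (by simp) h0 e.symm
  change hD.liftFun f (hD.specMap z) = _
  rw [liftFun, dif_pos h]
  congr 1
  · congr 1
    refine Subtype.ext ?_
    change I * (1 + ((z : ℂ) - I) / (z + I)) / (1 - ((z : ℂ) - I) / (z + I)) = z
    rw [e]; field_simp; ring
  · change (1 - ((z : ℂ) - I) / (z + I)) / (2 * I) = _
    rw [e]; field_simp

theorem ext_spectrum (hD : IsSelfadjointRegular A D) {g h : C(spectrum ℂ hD.cayley, ℂ)}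
    (h1 : ∀ w : spectrum ℂ hD.cayley, (w : ℂ) = 1 → g w = h w)
    (h2 : ∀ z, g (hD.specMap z) = h (hD.specMap z)) : g = h := by
  ext w
  rcases hD.cases_spectrum w with hw | ⟨z, rfl⟩
  · exact h1 w hw
  · exact h2 z

/-- `f(D)(D + i)⁻¹`, obtained from the continuous functional calculus of `C_D`. -/
def mulRes (hD : IsSelfadjointRegular A D) (f : spec D →ᵇ ℂ) : Adjointable A X :=
  cfcHom (R := ℂ) hD.isStarNormal_cayley (hD.lift f)

theorem mulRes_add (hD : IsSelfadjointRegular A D) (f g : spec D →ᵇ ℂ) :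
    hD.mulRes (f + g) = hD.mulRes f + hD.mulRes g := by
  rw [mulRes, mulRes, mulRes, ← map_add]
  congr 1
  refine hD.ext_spectrum (fun w hw => ?_) fun z => ?_
  · simp [lift_eq_zero, hw]
  · simp [lift_specMap, add_mul]

theorem mulRes_smul (hD : IsSelfadjointRegular A D) (c : ℂ) (f : spec D →ᵇ ℂ) :
    hD.mulRes (c • f) = c • hD.mulRes f := by
  rw [mulRes, mulRes, ← _root_.map_smul]
  congr 1
  refine hD.ext_spectrum (fun w hw => ?_) fun z => ?_
  · simp [lift_eq_zero, hw]
  · simp [lift_specMap, mul_assoc]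

theorem mulRes_one (hD : IsSelfadjointRegular A D) : hD.mulRes 1 = hD.res := by
  have : hD.lift 1 = (1 / (2 * I)) • (1 - ContinuousMap.restrict (spectrum ℂ hD.cayley)
      (ContinuousMap.id ℂ)) := by
    refine hD.ext_spectrum (fun w hw => ?_) fun z => ?_
    · simp [lift_eq_zero, hw]
    · have h0 := hD.add_I_ne_zero z.2
      have hI := Complex.I_ne_zero
      rw [lift_specMap]
      change 1 * ((z : ℂ) + I)⁻¹ = (1 / (2 * I)) * (1 - ((z : ℂ) - I) / (z + I))
      field_simp; ring
  rw [mulRes, this, _root_.map_smul, map_sub, map_one, cfcHom_id, res]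

theorem mulRes_cayleyFun (hD : IsSelfadjointRegular A D) :
    hD.mulRes hD.cayleyFun = hD.cayley * hD.res := by
  have : hD.lift hD.cayleyFun = ContinuousMap.restrict (spectrum ℂ hD.cayley)
      (ContinuousMap.id ℂ) * hD.lift 1 := by
    refine hD.ext_spectrum (fun w hw => ?_) fun z => ?_
    · simp [lift_eq_zero, hw]
    · rw [ContinuousMap.mul_apply, lift_specMap, lift_specMap]
      change ((z : ℂ) - I) * ((z : ℂ) + I)⁻¹ * _ = ((z : ℂ) - I) / (z + I) * (1 * _)
      ring
  rw [← mulRes_one, mulRes, this, map_mul, cfcHom_id]; rfl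

theorem star_mulRes_mul (hD : IsSelfadjointRegular A D) (f g : spec D →ᵇ ℂ) :
    star (hD.mulRes f) * hD.mulRes g = star hD.res * hD.mulRes (star f * g) := by
  rw [← mulRes_one, mulRes, mulRes, mulRes, mulRes, ← map_star, ← map_star, ← map_mul, ← map_mul]
  congr 1
  refine hD.ext_spectrum (fun w hw => ?_) fun z => ?_
  · simp [lift_eq_zero, hw]
  · simp [lift_specMap]; ring

theorem norm_mulRes_apply_le (hD : IsSelfadjointRegular A D) (f : spec D →ᵇ ℂ) (y : X) :
    ‖hD.mulRes f y‖ ≤ ‖f‖ * ‖hD.res y‖ := by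
  let u : spec D →ᵇ ℂ := BoundedContinuousFunction.ofNormedAddCommGroup
    (fun t => ((√(‖f‖ ^ 2 - ‖f t‖ ^ 2) : ℝ) : ℂ)) (by fun_prop) ‖f‖ fun t => by
      rw [Complex.norm_real, Real.norm_of_nonneg (Real.sqrt_nonneg _)]
      refine Real.sqrt_le_iff.2 ⟨norm_nonneg _, ?_⟩
      nlinarith [sq_nonneg ‖f t‖]
  have hu : star f * f + star u * u = ((‖f‖ ^ 2 : ℝ) : ℂ) • (1 : spec D →ᵇ ℂ) := by
    ext t
    have h1 : 0 ≤ ‖f‖ ^ 2 - ‖f t‖ ^ 2 := by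
      have := f.norm_coe_le_norm t
      nlinarith [norm_nonneg (f t)]
    have h2 : star (f t) * f t = ((‖f t‖ ^ 2 : ℝ) : ℂ) := by
      have := Complex.conj_mul' (f t)
      simpa using this
    have h3 : star (u t) * u t = ((‖f‖ ^ 2 - ‖f t‖ ^ 2 : ℝ) : ℂ) := by
      change star ((√(‖f‖ ^ 2 - ‖f t‖ ^ 2) : ℝ) : ℂ) * ((√(‖f‖ ^ 2 - ‖f t‖ ^ 2) : ℝ) : ℂ) = _
      rw [Complex.star_def, Complex.conj_ofReal, ← Complex.ofReal_mul, Real.mul_self_sqrt h1]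
    change star (f t) * f t + star (u t) * u t = ((‖f‖ ^ 2 : ℝ) : ℂ) * 1
    rw [h2, h3]; push_cast; ring
  have key : star (hD.mulRes f) * hD.mulRes f + star (hD.mulRes u) * hD.mulRes u
      = ((‖f‖ ^ 2 : ℝ) : ℂ) • (star hD.res * hD.res) := by
    rw [star_mulRes_mul, star_mulRes_mul, ← mul_add, ← mulRes_add, hu, mulRes_smul, mulRes_one,
      mul_smul_comm]
  have key2 : inner A (hD.mulRes f y) (hD.mulRes f y) + inner A (hD.mulRes u y) (hD.mulRes u y)
      = ((‖f‖ ^ 2 : ℝ) : ℂ) • inner A (hD.res y) (hD.res y) := by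
    have := congrArg (fun T : Adjointable A X => inner A y (T y)) key
    simp only [Adjointable.add_apply, Adjointable.mul_apply, Adjointable.smul_apply,
      CStarModule.inner_add_right, CStarModule.inner_smul_right_complex] at this
    simpa only [inner_apply_left (A := A)] using this
  have h1 : inner A (hD.mulRes f y) (hD.mulRes f y)
      ≤ ((‖f‖ ^ 2 : ℝ) : ℂ) • inner A (hD.res y) (hD.res y) := by
    rw [← key2]; exact le_add_of_nonneg_right CStarModule.inner_self_nonneg
  have h2 := CStarAlgebra.norm_le_norm_of_nonneg_of_le CStarModule.inner_self_nonneg h1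
  rw [norm_smul, Complex.norm_real, Real.norm_of_nonneg (by positivity), ← CStarModule.norm_sq_eq A,
    ← CStarModule.norm_sq_eq A, ← mul_pow] at h2
  exact abs_le_of_sq_le_sq' h2 (by positivity) |>.2

/-- The bounded operator `f(D)`, determined by `f(D)(D + i)⁻¹`. -/
def calcCLM (hD : IsSelfadjointRegular A D) (f : spec D →ᵇ ℂ) : X →L[ℂ] X :=
  LinearMap.extendOfNorm (Adjointable.toCLM (hD.mulRes f)).toLinearMap
    (Adjointable.toCLM hD.res).toLinearMap

theorem calcCLM_res (hD : IsSelfadjointRegular A D) (f : spec D →ᵇ ℂ) (y : X) :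
    hD.calcCLM f (hD.res y) = hD.mulRes f y :=
  LinearMap.extendOfNorm_eq (f := (Adjointable.toCLM (hD.mulRes f)).toLinearMap)
    (e := (Adjointable.toCLM hD.res).toLinearMap) hD.denseRange_res
    ⟨‖f‖, hD.norm_mulRes_apply_le f⟩ y

theorem ext_res (hD : IsSelfadjointRegular A D) {S T : X →L[ℂ] X}
    (h : ∀ y, S (hD.res y) = T (hD.res y)) : S = T :=
  ContinuousLinearMap.ext fun x => congrFun
    (hD.denseRange_res.equalizer S.continuous T.continuous (funext h)) x

theorem inner_calcCLM (hD : IsSelfadjointRegular A D) (f : spec D →ᵇ ℂ) (x y : X) :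
    inner A (hD.calcCLM f x) y = inner A x (hD.calcCLM (star f) y) := by
  have c : Continuous fun p : X × X => inner A p.1 p.2 := CStarModule.continuous_inner
  refine congrFun (hD.denseRange_res.equalizer
    (c.comp ((hD.calcCLM f).continuous.prodMk continuous_const))
    (c.comp (continuous_id.prodMk continuous_const)) (funext fun u => ?_)) x
  refine congrFun (hD.denseRange_res.equalizer
    (c.comp (continuous_const.prodMk continuous_id))
    (c.comp (continuous_const.prodMk (hD.calcCLM (star f)).continuous)) (funext fun v => ?_)) y
  change inner A (hD.calcCLM f (hD.res u)) (hD.res v)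
    = inner A (hD.res u) (hD.calcCLM (star f) (hD.res v))
  rw [calcCLM_res, calcCLM_res, inner_apply_left, inner_apply_left hD.res]
  have := congrArg (fun T : Adjointable A X => T v) (hD.star_mulRes_mul f 1)
  simp only [Adjointable.mul_apply, mulRes_one, mul_one] at this
  rw [this]

/-- The adjointable operator `f(D)`. -/
def bddCalc (hD : IsSelfadjointRegular A D) (f : spec D →ᵇ ℂ) : Adjointable A X :=
  Adjointable.mk (hD.calcCLM f) (hD.calcCLM (star f)) (hD.inner_calcCLM f)

theorem bddCalc_mul_res (hD : IsSelfadjointRegular A D) (f : spec D →ᵇ ℂ) :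
    hD.bddCalc f * hD.res = hD.mulRes f := Adjointable.ext (hD.calcCLM_res f)

theorem ext_mul_res (hD : IsSelfadjointRegular A D) {S T : Adjointable A X}
    (h : S * hD.res = T * hD.res) : S = T :=
  Subtype.ext (hD.ext_res fun y => congrArg (fun T : Adjointable A X => T y) h)

theorem star_bddCalc (hD : IsSelfadjointRegular A D) (f : spec D →ᵇ ℂ) :
    star (hD.bddCalc f) = hD.bddCalc (star f) := star_eq_of (hD.inner_calcCLM f)

theorem bddCalc_mul (hD : IsSelfadjointRegular A D) (f g : spec D →ᵇ ℂ) :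
    hD.bddCalc (f * g) = hD.bddCalc f * hD.bddCalc g := by
  have h : star (hD.bddCalc (f * g) * hD.res) * hD.res
      = star (hD.bddCalc f * hD.bddCalc g * hD.res) * hD.res := by
    rw [mul_assoc (hD.bddCalc f), star_mul (hD.bddCalc f), star_bddCalc, bddCalc_mul_res, bddCalc_mul_res, mul_assoc,
      bddCalc_mul_res, star_mulRes_mul, ← mulRes_one, star_mulRes_mul, mul_one, star_mul, mul_comm,
      mulRes_one]
  have h' : star (hD.bddCalc (f * g) * hD.res) = star (hD.bddCalc f * hD.bddCalc g * hD.res) :=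
    hD.ext_mul_res h
  exact hD.ext_mul_res (star_injective h')

/-- The functional calculus, as a unital ⋆-homomorphism. -/
def calcHom (hD : IsSelfadjointRegular A D) : (spec D →ᵇ ℂ) →⋆ₐ[ℂ] Adjointable A X where
  toFun := hD.bddCalc
  map_one' := hD.ext_mul_res (by rw [bddCalc_mul_res, mulRes_one, one_mul])
  map_mul' := hD.bddCalc_mul
  map_zero' := hD.ext_mul_res (by
    rw [bddCalc_mul_res, ← zero_smul ℂ (0 : spec D →ᵇ ℂ), mulRes_smul, zero_smul, zero_mul])
  map_add' f g := hD.ext_mul_res (by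
    rw [add_mul, bddCalc_mul_res, bddCalc_mul_res, bddCalc_mul_res, mulRes_add])
  commutes' c := hD.ext_mul_res (by
    rw [bddCalc_mul_res, Algebra.algebraMap_eq_smul_one, Algebra.algebraMap_eq_smul_one, mulRes_smul,
      mulRes_one, smul_mul_assoc, one_mul])
  map_star' f := (hD.star_bddCalc f).symm

/-- Restriction along `specMap`. -/
def pullback (hD : IsSelfadjointRegular A D) :
    C(spectrum ℂ hD.cayley, ℂ) →⋆ₐ[ℂ] (spec D →ᵇ ℂ) where
  toFun g := (BoundedContinuousFunction.mkOfCompact g).compContinuous hD.specMap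
  map_one' := rfl
  map_mul' _ _ := rfl
  map_zero' := rfl
  map_add' _ _ := rfl
  commutes' _ := rfl
  map_star' _ := rfl

/-- There is a unique unital ⋆-homomorphism `Ψ : C_b(σ(D)) → 𝓛(X)` which maps
`t ↦ (t - i)(t + i)⁻¹` to the Cayley transform of `D`. -/
theorem existsUnique_functionalCalculus (hD : IsSelfadjointRegular A D) :
    ∃! Ψ : (spec D →ᵇ ℂ) →⋆ₐ[ℂ] Adjointable A X, Ψ hD.cayleyFun = hD.cayley := by
  refine ⟨hD.calcHom, hD.ext_mul_res ?_, fun Φ hΦ => ?_⟩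
  · exact (hD.bddCalc_mul_res _).trans hD.mulRes_cayleyFun
  · have h1 : cfcHom (R := ℂ) hD.isStarNormal_cayley = Φ.comp hD.pullback := by
      refine cfcHom_eq_of_continuous_of_map_id _ _ ?_ ?_
      · exact AddMonoidHomClass.continuous_of_bound (Φ.comp hD.pullback) 1 fun g => by
          rw [one_mul]; exact NonUnitalStarAlgHom.norm_apply_le (Φ.comp hD.pullback) g
      · refine Eq.trans ?_ hΦ
        change Φ (hD.pullback _) = _
        congr 1
    have h2 : ∀ f, hD.mulRes f = Φ f * Φ (hD.pullback (hD.lift 1)) := by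
      intro f
      rw [mulRes, h1, ← map_mul]
      change Φ (hD.pullback _) = _
      congr 1
      ext z
      change hD.lift f (hD.specMap z) = f z * hD.lift 1 (hD.specMap z)
      rw [lift_specMap, lift_specMap]
      change _ = f z * (1 * _)
      ring
    have h3 : Φ (hD.pullback (hD.lift 1)) = hD.res := by
      rw [← hD.mulRes_one, h2, map_one, one_mul]
    refine StarAlgHom.ext fun f => hD.ext_mul_res ?_
    change _ = hD.bddCalc f * hD.res
    rw [hD.bddCalc_mul_res, h2, h3]

/-- The continuous functional calculus of `D`: the unique unital ⋆-homomorphism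
`Ψ : C_b(σ(D)) → 𝓛(X)` with `Ψ((t - i)(t + i)⁻¹) = C_D`. -/
def functionalCalculus (hD : IsSelfadjointRegular A D) :
    (spec D →ᵇ ℂ) →⋆ₐ[ℂ] Adjointable A X :=
  hD.existsUnique_functionalCalculus.choose

theorem functionalCalculus_cayleyFun (hD : IsSelfadjointRegular A D) :
    hD.functionalCalculus hD.cayleyFun = hD.cayley :=
  hD.existsUnique_functionalCalculus.choose_spec.1

/-- `f(D)` for a bounded continuous function `f : ℝ → ℂ`, which is restricted to `σ(D) ⊆ ℝ`. -/
def applyFun (hD : IsSelfadjointRegular A D) (f : ℝ →ᵇ ℂ) : Adjointable A X :=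
  hD.functionalCalculus (f.compContinuous ⟨fun t : spec D => (t : ℂ).re, by fun_prop⟩)

/-- For `ρ > 0` the operator `ρ⁻¹ D`, with domain `Dom(D)`, is selfadjoint and regular. -/
theorem inv_smul (hD : IsSelfadjointRegular A D) {ρ : ℝ} (hρ : 0 < ρ) :
    IsSelfadjointRegular A ((ρ : ℂ)⁻¹ • D) := by
  have hρ' : (ρ : ℂ) ≠ 0 := by exact_mod_cast hρ.ne'
  have hs : ∀ s : ℝ, s ≠ 0 → Function.Surjective (shift D (s * I)) := by
    intro s hs
    have : ¬ (s * I ∈ spec D) := fun h => hs (by simpa using hD.im_eq_zero h)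
    exact (not_not.1 this).2
  refine ⟨hD.dense_domain, hD.smul_mem, fun a x => ?_, fun x y => ?_, fun y => ?_, fun y => ?_⟩
  · change (ρ : ℂ)⁻¹ • D _ = a • ((ρ : ℂ)⁻¹ • D x)
    rw [hD.map_smul a x]
    refine inner_ext (A := A) fun y => ?_
    simp [mul_smul_comm]
  · change inner A ((ρ : ℂ)⁻¹ • D x) (y : X) = inner A (x : X) ((ρ : ℂ)⁻¹ • D y)
    have : star ((ρ : ℂ)⁻¹) = (ρ : ℂ)⁻¹ := by
      rw [← Complex.ofReal_inv, Complex.star_def, Complex.conj_ofReal]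
    rw [CStarModule.inner_smul_left_complex, CStarModule.inner_smul_right_complex, hD.symmetric,
      this]
  · obtain ⟨x, hx⟩ := hs (-ρ) (neg_ne_zero.2 hρ.ne') ((ρ : ℂ) • y)
    refine ⟨x, ?_⟩
    change (ρ : ℂ)⁻¹ • D x + I • (x : X) = y
    rw [eq_comm, ← inv_smul_smul₀ hρ' y, ← hx, shift_apply, smul_sub, smul_smul]
    push_cast
    rw [← mul_assoc, mul_neg, inv_mul_cancel₀ hρ']
    module
  · obtain ⟨x, hx⟩ := hs ρ hρ.ne' ((ρ : ℂ) • y)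
    refine ⟨x, ?_⟩
    change (ρ : ℂ)⁻¹ • D x - I • (x : X) = y
    rw [eq_comm, ← inv_smul_smul₀ hρ' y, ← hx, shift_apply, smul_sub, smul_smul,
      ← mul_assoc, inv_mul_cancel₀ hρ', one_mul]

end IsSelfadjointRegular

/-- `T` is a Lipschitz operator with respect to `D`: `T` maps `Dom(D)` into itself and the
commutator `[D, T] = DT - TD : Dom(D) → X` extends to a bounded adjointable operator. -/
structure IsLipschitz (D : X →ₗ.[ℂ] X) (T : Adjointable A X) : Prop where
  map_mem : ∀ x : D.domain, T x ∈ D.domain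
  exists_extension : ∃ S : Adjointable A X,
    ∀ x : D.domain, S x = D ⟨T x, map_mem x⟩ - T (D x)

/-- The bounded adjointable extension `d(T)` of `[D, T]`; it is unique, since `Dom(D)` is dense. -/
def IsLipschitz.derivation {D : X →ₗ.[ℂ] X} {T : Adjointable A X} (hT : IsLipschitz D T) :
    Adjointable A X := hT.exists_extension.choose

theorem IsLipschitz.derivation_apply {D : X →ₗ.[ℂ] X} {T : Adjointable A X}
    (hT : IsLipschitz D T) (x : D.domain) :
    hT.derivation x = D ⟨T x, hT.map_mem x⟩ - T (D x) := hT.exists_extension.choose_spec x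

end Unbounded

/-- The Fourier transform `f̂(p) = (2π)^(-1/2) ∫ f(x) e^(-ixp) dx`. -/
def fourierTransform (f : ℝ → ℂ) (p : ℝ) : ℂ :=
  ((1 / √(2 * Real.pi) : ℝ) : ℂ) * ∫ x : ℝ, f x * Complex.exp (-(Complex.I * x * p))

end HilbertModule

end

noncomputable section

namespace HilbertModule

/-! ### Scalar resolvents and exponentials in `C_b(ℝ)` -/

open Complex (I)

/-! By Fourier inversion f(D) = (2π)^(-1/2) ∫ f̂(p) e^(ipD) dp, read strongly on Dom(D). Hence
[f(D), T] is the same integral of f̂(p) [e^(ipD), T], and everything follows from ‖[e^(ipD), T]‖ ≤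
|p| ‖d(T)‖.

This estimate (`norm_exp_commutator_le`) is obtained without differentiating e^(ipD). The resolvent
R_s = (1 - isD)⁻¹ is a contraction, and [R_s, T] = is R_s d(T) R_s (`resolvent_commutator`), so
‖[R_s, T]‖ ≤ |s| ‖d(T)‖. Since [·, T] is a derivation, the n-th power of R_(p/n) has commutator at
most n · |p/n| · ‖d(T)‖ = |p| ‖d(T)‖. These powers converge strongly to e^(ipD)
(`tendsto_resolvent_pow`), and the bound survives the strong limit.

Both the convergence and the integral formula are first proved for functions in the sup norm, then
carried to X by the contractive homomorphism f ↦ f(D). Neither holds in the sup norm as it stands,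
because t is unbounded; multiplying by powers of (1 - it)⁻¹ absorbs the growth. On the operator side
this costs only a restriction to vectors in the range of a power of (D + i)⁻¹, which is dense. The
second inequality is the first one for ρ⁻¹D, whose derivation is ρ⁻¹ d(T). -/

theorem one_le_norm_one_sub_I_mul (s t : ℝ) : 1 ≤ ‖(1 : ℂ) - I * s * t‖ := by
  simpa using Complex.abs_re_le_norm ((1 : ℂ) - I * s * t)

theorem abs_mul_le_norm_one_sub_I_mul (s t : ℝ) : |s * t| ≤ ‖(1 : ℂ) - I * s * t‖ := by
  simpa using Complex.abs_im_le_norm ((1 : ℂ) - I * s * t)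

theorem one_sub_I_mul_ne_zero (s t : ℝ) : (1 : ℂ) - I * s * t ≠ 0 :=
  norm_pos_iff.1 (zero_lt_one.trans_le (one_le_norm_one_sub_I_mul s t))

/-- The bounded continuous function `t ↦ (1 - i s t)⁻¹`. -/
def resolventFun (s : ℝ) : ℝ →ᵇ ℂ :=
  BoundedContinuousFunction.ofNormedAddCommGroup (fun t => ((1 : ℂ) - I * s * t)⁻¹)
    (Continuous.inv₀ (by fun_prop) (one_sub_I_mul_ne_zero s)) 1
    fun t => by
      rw [norm_inv]
      exact inv_le_one_of_one_le₀ (one_le_norm_one_sub_I_mul s t)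

theorem resolventFun_apply (s t : ℝ) : resolventFun s t = ((1 : ℂ) - I * s * t)⁻¹ := rfl

theorem norm_resolventFun_apply_le (s t : ℝ) : ‖resolventFun s t‖ ≤ 1 := by
  rw [resolventFun_apply, norm_inv]
  exact inv_le_one_of_one_le₀ (one_le_norm_one_sub_I_mul s t)

/-- The bounded continuous function `t ↦ e^(ipt)`. -/
def expFun (p : ℝ) : ℝ →ᵇ ℂ :=
  BoundedContinuousFunction.ofNormedAddCommGroup (fun t => Complex.exp (I * (p * t : ℝ)))
    (by fun_prop) 1 fun t => (Complex.norm_exp_I_mul_ofReal _).le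

theorem expFun_apply (p t : ℝ) : expFun p t = Complex.exp (I * (p * t : ℝ)) := rfl

theorem norm_expFun_apply (p t : ℝ) : ‖expFun p t‖ = 1 := Complex.norm_exp_I_mul_ofReal _

/-- Telescoping. Bounding all powers, the zeroth included, avoids assuming ‖1‖ = 1. -/
theorem norm_pow_sub_pow_le {R : Type*} [NormedCommRing R] {a b : R} (ha : ∀ n : ℕ, ‖a ^ n‖ ≤ 1)
    (hb : ∀ n : ℕ, ‖b ^ n‖ ≤ 1) (n : ℕ) : ‖a ^ n - b ^ n‖ ≤ n * ‖a - b‖ := by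
  induction n with
  | zero => simp
  | succ n ih =>
    have e : a ^ (n + 1) - b ^ (n + 1) = a ^ n * (a - b) + (a ^ n - b ^ n) * b := by ring
    have hb1 : ‖b‖ ≤ 1 := by simpa using hb 1
    calc ‖a ^ (n + 1) - b ^ (n + 1)‖ ≤ ‖a ^ n‖ * ‖a - b‖ + ‖a ^ n - b ^ n‖ * ‖b‖ := by
          rw [e]
          exact (norm_add_le _ _).trans (add_le_add (norm_mul_le _ _) (norm_mul_le _ _))
      _ ≤ 1 * ‖a - b‖ + n * ‖a - b‖ * 1 := by
          gcongr
          exact ha n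
      _ = _ := by push_cast; ring

/-- Leibniz rule: [aⁿ, b] is a sum of n terms, each containing [a, b] once between powers of a. As
above, the hypothesis covers `a ^ 0`; the condition ‖1‖ = 1 would fail for operators on X = 0. -/
theorem norm_pow_commutator_le {R : Type*} [NormedRing R] {a b : R} {c : ℝ}
    (ha : ∀ n : ℕ, ‖a ^ n‖ ≤ 1) (h : ‖a * b - b * a‖ ≤ c) (n : ℕ) :
    ‖a ^ n * b - b * a ^ n‖ ≤ n * c := by
  have hc : 0 ≤ c := (norm_nonneg _).trans h
  induction n with
  | zero => simp
  | succ n ih =>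
    have e : a ^ (n + 1) * b - b * a ^ (n + 1)
        = a ^ n * (a * b - b * a) + (a ^ n * b - b * a ^ n) * a := by
      rw [pow_succ]; noncomm_ring
    have ha1 : ‖a‖ ≤ 1 := by simpa using ha 1
    calc ‖a ^ (n + 1) * b - b * a ^ (n + 1)‖
        ≤ ‖a ^ n‖ * ‖a * b - b * a‖ + ‖a ^ n * b - b * a ^ n‖ * ‖a‖ := by
          rw [e]
          exact (norm_add_le _ _).trans (add_le_add (norm_mul_le _ _) (norm_mul_le _ _))
      _ ≤ 1 * c + n * c * 1 := by
          gcongr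
          exact ha n
      _ = _ := by push_cast; ring

theorem norm_one_sub_I_mul_sub_exp_le (u : ℝ) :
    ‖(1 : ℂ) - I * u - Complex.exp (-(I * u))‖ ≤ 3 * u ^ 2 := by
  rcases le_total |u| 1 with hu | hu
  · have h := Complex.norm_exp_sub_one_sub_id_le (x := -(I * u)) (by simpa using hu)
    rw [norm_sub_rev]
    calc _ = ‖Complex.exp (-(I * u)) - 1 - -(I * u)‖ := by congr 1; ring
      _ ≤ ‖-(I * (u : ℂ))‖ ^ 2 := h
      _ = u ^ 2 := by simp
      _ ≤ 3 * u ^ 2 := by nlinarith [sq_nonneg u]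
  -- For |u| ≥ 1 the crude bound 1 + |u| + 1 suffices, each summand being at most u²; this is the
  -- source of the constant 3.
  · have h1 : ‖Complex.exp (-(I * u))‖ = 1 := by
      simpa using Complex.norm_exp_I_mul_ofReal (-u)
    have h2 : ‖(1 : ℂ) - I * u‖ ≤ 1 + |u| := (norm_sub_le _ _).trans (by simp)
    have h3 := norm_sub_le ((1 : ℂ) - I * u) (Complex.exp (-(I * u)))
    have h4 : u ^ 2 = |u| ^ 2 := (sq_abs u).symm
    nlinarith

/-- With u = st, the difference (1 - iu)⁻¹ - e^(iu) is -(1 - iu)⁻¹ e^(iu) (1 - iu - e^(-iu)), where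
the first two factors have modulus at most 1. -/
theorem norm_resolventFun_sub_expFun_le (s t : ℝ) :
    ‖resolventFun s t - expFun s t‖ ≤ 3 * (s * t) ^ 2 := by
  have h0 := one_sub_I_mul_ne_zero s t
  have e : resolventFun s t - expFun s t = -(resolventFun s t * expFun s t *
      ((1 : ℂ) - I * (s * t : ℝ) - Complex.exp (-(I * (s * t : ℝ))))) := by
    rw [resolventFun_apply, expFun_apply, Complex.exp_neg]
    have h1 := inv_mul_cancel₀ h0
    have h2 := mul_inv_cancel₀ (Complex.exp_ne_zero (I * (s * t : ℝ)))
    rw [Complex.ofReal_mul] at h2 ⊢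
    linear_combination Complex.exp (I * (s * t)) * h1 - ((1 : ℂ) - I * s * t)⁻¹ * h2
  rw [e, norm_neg, norm_mul, norm_mul, norm_expFun_apply, mul_one]
  calc _ ≤ 1 * (3 * (s * t) ^ 2) := mul_le_mul (norm_resolventFun_apply_le s t)
        (norm_one_sub_I_mul_sub_exp_le _) (norm_nonneg _) zero_le_one
    _ = _ := one_mul _

theorem expFun_div_pow (p : ℝ) {n : ℕ} (hn : n ≠ 0) : expFun (p / n) ^ n = expFun p := by
  ext t
  rw [BoundedContinuousFunction.coe_pow, Pi.pow_apply, expFun_apply, expFun_apply,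
    ← Complex.exp_nat_mul]
  congr 1
  have : (n : ℂ) ≠ 0 := by exact_mod_cast hn
  push_cast
  field_simp

theorem norm_resolventFun_pow_le (s : ℝ) (n : ℕ) : ‖resolventFun s ^ n‖ ≤ 1 := by
  rw [BoundedContinuousFunction.norm_le zero_le_one]
  intro t
  rw [BoundedContinuousFunction.coe_pow, Pi.pow_apply, norm_pow]
  exact pow_le_one₀ (norm_nonneg _) (norm_resolventFun_apply_le s t)

theorem norm_expFun_le (p : ℝ) : ‖expFun p‖ ≤ 1 :=
  (BoundedContinuousFunction.norm_le zero_le_one).2 fun t => (norm_expFun_apply p t).le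

theorem norm_mul_resolventFun_one_le (t : ℝ) : |t| * ‖resolventFun 1 t‖ ≤ 1 := by
  rw [resolventFun_apply, norm_inv, ← div_eq_mul_inv]
  refine div_le_one_of_le₀ ?_ (norm_nonneg _)
  simpa using abs_mul_le_norm_one_sub_I_mul 1 t

/-- Euler's approximation of e^(ipt), made uniform in t. Telescoping gives the error n · 3(pt/n)² =
3p²t²/n, and each factor (1 - it)⁻¹ absorbs one power of |t|. -/
theorem norm_resolventFun_pow_sub_expFun_mul_le (p : ℝ) {n : ℕ} (hn : n ≠ 0) :
    ‖(resolventFun (p / n) ^ n - expFun p) * (resolventFun 1 * resolventFun 1)‖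
      ≤ 3 * p ^ 2 / n := by
  have hn' : (0 : ℝ) < n := by positivity
  rw [BoundedContinuousFunction.norm_le (by positivity)]
  intro t
  have h1 : ‖resolventFun (p / n) t ^ n - expFun (p / n) t ^ n‖ ≤ n * (3 * (p / n * t) ^ 2) := by
    refine (norm_pow_sub_pow_le (fun k => ?_) (fun k => ?_) n).trans ?_
    · rw [norm_pow]
      exact pow_le_one₀ (norm_nonneg _) (norm_resolventFun_apply_le _ t)
    · rw [norm_pow, norm_expFun_apply, one_pow]
    · gcongr
      exact norm_resolventFun_sub_expFun_le _ t
  have h2 : ‖(resolventFun (p / n) ^ n - expFun p) t‖ ≤ 3 * p ^ 2 / n * |t| ^ 2 := by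
    rw [← expFun_div_pow p hn]
    refine h1.trans_eq ?_
    rw [sq_abs]
    field_simp
  calc _ = ‖(resolventFun (p / n) ^ n - expFun p) t‖ * (‖resolventFun 1 t‖ * ‖resolventFun 1 t‖) := by
        rw [BoundedContinuousFunction.mul_apply, BoundedContinuousFunction.mul_apply, norm_mul,
          norm_mul]
    _ ≤ 3 * p ^ 2 / n * |t| ^ 2 * (‖resolventFun 1 t‖ * ‖resolventFun 1 t‖) := by gcongr
    _ = 3 * p ^ 2 / n * (|t| * ‖resolventFun 1 t‖) ^ 2 := by ring
    _ ≤ 3 * p ^ 2 / n * 1 := by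
        gcongr
        exact pow_le_one₀ (by positivity) (norm_mul_resolventFun_one_le t)
    _ = _ := mul_one _

/-- In the sup norm p ↦ e^(ip·) is nowhere continuous: distinct p and q give functions at distance
2. The factor (1 - it)⁻¹ absorbs the |t| in |e^(ipt) - e^(iqt)| ≤ |p - q| |t|, and makes Bochner
integration in `C_b(ℝ)` possible. -/
theorem norm_expFun_sub_mul_resolventFun_le (p q : ℝ) :
    ‖expFun p * resolventFun 1 - expFun q * resolventFun 1‖ ≤ |p - q| := by
  rw [BoundedContinuousFunction.norm_le (abs_nonneg _)]
  intro t
  have e : expFun p t - expFun q t = expFun q t * (Complex.exp (I * ((p - q) * t : ℝ)) - 1) := by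
    rw [expFun_apply, expFun_apply, mul_sub, ← Complex.exp_add, mul_one]
    congr 2
    push_cast
    ring
  have h : ‖expFun p t - expFun q t‖ ≤ |p - q| * |t| := by
    rw [e, norm_mul, norm_expFun_apply, one_mul, ← abs_mul]
    exact Real.norm_exp_I_mul_ofReal_sub_one_le
  calc _ = ‖expFun p t - expFun q t‖ * ‖resolventFun 1 t‖ := by
        rw [← norm_mul, sub_mul]; rfl
    _ ≤ |p - q| * |t| * ‖resolventFun 1 t‖ := by gcongr
    _ = |p - q| * (|t| * ‖resolventFun 1 t‖) := by ring
    _ ≤ |p - q| * 1 := by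
        gcongr
        exact norm_mul_resolventFun_one_le t
    _ = _ := mul_one _

theorem continuous_expFun_mul_resolventFun :
    Continuous fun p => expFun p * resolventFun 1 :=
  (LipschitzWith.of_dist_le_mul (K := 1) fun p q => by
    rw [dist_eq_norm, NNReal.coe_one, one_mul, Real.dist_eq]
    exact norm_expFun_sub_mul_resolventFun_le p q).continuous

/-! ### Fourier inversion, for scalars and in `C_b(ℝ)` -/

section Fourier

open MeasureTheory FourierTransform Real

theorem fourierTransform_eq (f : ℝ → ℂ) (p : ℝ) :
    fourierTransform f p = ((1 / √(2 * π) : ℝ) : ℂ) * 𝓕 f (p / (2 * π)) := by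
  rw [fourierTransform, Real.fourier_real_eq_integral_exp_smul]
  congr 2
  ext x
  rw [smul_eq_mul, mul_comm]
  congr 2
  have : (π : ℂ) ≠ 0 := by exact_mod_cast pi_ne_zero
  push_cast
  field_simp

theorem continuous_fourier_of_integrable {f : ℝ → ℂ} (hf : Integrable f) : Continuous (𝓕 f) :=
  VectorFourier.fourierIntegral_continuous Real.continuous_fourierChar
    (by exact continuous_inner) hf

theorem continuous_fourierTransform {f : ℝ → ℂ} (hf : Integrable f) :
    Continuous (fourierTransform f) := by
  rw [funext (fourierTransform_eq f)]
  have := continuous_fourier_of_integrable hf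
  fun_prop

/-- On [-1, 1] the transform is continuous, hence integrable; outside, it is dominated by p · f̂(p).
-/
theorem integrable_fourierTransform {f : ℝ → ℂ} (hf : Integrable f)
    (hpf : Integrable fun p : ℝ => (p : ℂ) * fourierTransform f p) :
    Integrable (fourierTransform f) := by
  have hc := continuous_fourierTransform hf
  rw [← integrableOn_univ, ← Set.union_compl_self (Set.Icc (-1 : ℝ) 1)]
  refine (hc.continuousOn.integrableOn_compact isCompact_Icc).union ?_
  refine Integrable.mono hpf.integrableOn hc.aestronglyMeasurable.restrict ?_
  refine (ae_restrict_iff' measurableSet_Icc.compl).2 (.of_forall fun p hp => ?_)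
  have h1 : 1 ≤ |p| := by
    by_contra h
    exact hp (abs_le.1 (not_le.1 h).le)
  rw [norm_mul, Complex.norm_real, Real.norm_eq_abs]
  exact le_mul_of_one_le_left (norm_nonneg _) h1

theorem integrable_fourier {f : ℝ → ℂ} (h : Integrable (fourierTransform f)) :
    Integrable (𝓕 f) := by
  have hs : √(2 * π) ≠ 0 := by positivity
  have h2 := (h.comp_mul_right' (R := 2 * π) (by positivity)).const_mul ((√(2 * π) : ℝ) : ℂ)
  refine h2.congr (.of_forall fun w => ?_)
  have hs' : ((√(2 * π) : ℝ) : ℂ) ≠ 0 := by exact_mod_cast hs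
  simp only [fourierTransform_eq]
  rw [mul_div_cancel_right₀ _ (by positivity), ← mul_assoc, ← Complex.ofReal_mul,
    mul_one_div_cancel hs, Complex.ofReal_one, one_mul]

/-- Fourier inversion for `fourierTransform`. -/
theorem integral_fourierTransform_mul_expFun {f : ℝ → ℂ} (hc : Continuous f) (hf : Integrable f)
    (hF : Integrable (fourierTransform f)) (t : ℝ) :
    ((1 / √(2 * π) : ℝ) : ℂ) * ∫ p, fourierTransform f p * expFun p t = f t := by
  have h := congrFun (hc.fourierInv_fourier_eq hf (integrable_fourier hF)) t
  rw [Real.fourierInv_eq'] at h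
  have h2 := Measure.integral_comp_div
    (fun v : ℝ => Complex.exp (↑(2 * π * inner ℝ v t) * I) • 𝓕 f v) (2 * π)
  rw [h] at h2
  have e : ∀ p, fourierTransform f p * expFun p t = ((1 / √(2 * π) : ℝ) : ℂ) *
      (Complex.exp (↑(2 * π * inner ℝ (p / (2 * π)) t) * I) • 𝓕 f (p / (2 * π))) := by
    intro p
    have e2 : 2 * π * inner ℝ (p / (2 * π)) t = p * t := by
      simp only [RCLike.inner_apply, conj_trivial]
      field_simp
    rw [e2, fourierTransform_eq, expFun_apply, smul_eq_mul, mul_comm I]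
    ring
  simp_rw [e]
  rw [integral_const_mul, h2, abs_of_pos (by positivity), Complex.real_smul, ← mul_assoc, ← mul_assoc,
    ← Complex.ofReal_mul, ← Complex.ofReal_mul]
  -- The Jacobian 2π of p ↦ p/(2π) cancels the two normalising factors, one from the transform and
  -- one from the inversion.
  have : 1 / √(2 * π) * (1 / √(2 * π)) * (2 * π) = 1 := by
    rw [div_mul_div_comm, Real.mul_self_sqrt (by positivity), one_mul,
      one_div_mul_cancel (by positivity)]
  rw [this, Complex.ofReal_one, one_mul]

theorem integrable_fourierTransform_smul {f : ℝ → ℂ} (hF : Integrable (fourierTransform f)) :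
    Integrable fun p => fourierTransform f p • (expFun p * resolventFun 1) := by
  refine hF.norm.mono' (hF.aestronglyMeasurable.smul
    continuous_expFun_mul_resolventFun.aestronglyMeasurable) (.of_forall fun p => ?_)
  rw [norm_smul]
  refine mul_le_of_le_one_right (norm_nonneg _) ((norm_mul_le _ _).trans ?_)
  exact mul_le_one₀ (norm_expFun_le p) (norm_nonneg _) (by simpa using norm_resolventFun_pow_le 1 1)

/-- Point evaluations are continuous functionals on `C_b(ℝ)`, so they pass through the Bochner
integral and reduce the identity to scalar inversion. -/
theorem integral_fourierTransform_smul (f : ℝ →ᵇ ℂ) (hf : Integrable fun x => f x)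
    (hF : Integrable (fourierTransform f)) :
    ((1 / √(2 * π) : ℝ) : ℂ) • ∫ p, fourierTransform f p • (expFun p * resolventFun 1)
      = f * resolventFun 1 := by
  ext t
  have h := (BoundedContinuousFunction.evalCLM ℂ t).integral_comp_comm
    (integrable_fourierTransform_smul hF)
  change _ * BoundedContinuousFunction.evalCLM ℂ t _ = f t * _
  rw [← h, ← integral_fourierTransform_mul_expFun f.continuous hf hF t, mul_assoc,
    ← integral_mul_const]
  congr 2
  ext p
  exact (mul_assoc _ _ _).symm

end Fourier

end HilbertModule

namespace HilbertModule

/-! ### Strong convergence and density -/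

open Complex (I)
open Filter Topology

theorem tendsto_zero_of_denseRange {E F : Type*} [NormedAddCommGroup E] [NormedSpace ℂ E]
    [NormedAddCommGroup F] [NormedSpace ℂ F] {ι : Type*} {l : Filter ι} {u : ι → E →L[ℂ] F} {C : ℝ}
    (hu : ∀ i, ‖u i‖ ≤ C) {Y : Type*} {j : Y → E} (hj : DenseRange j)
    (h : ∀ y, Tendsto (fun i => u i (j y)) l (𝓝 0)) (x : E) :
    Tendsto (fun i => u i x) l (𝓝 0) := by
  rw [Metric.tendsto_nhds]
  intro ε hε
  -- `|C| + 1` replaces `C` so that the denominator is positive in every case.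
  obtain ⟨y, hy⟩ := hj.exists_dist_lt x (ε := ε / (2 * (|C| + 1))) (by positivity)
  filter_upwards [Metric.tendsto_nhds.1 (h y) (ε / 2) (by positivity)] with i hi
  rw [dist_zero_right] at hi ⊢
  have h1 : ‖u i (x - j y)‖ ≤ (|C| + 1) * ‖x - j y‖ := by
    refine ((u i).le_opNorm _).trans ?_
    gcongr
    exact (hu i).trans (by linarith [le_abs_self C])
  have h2 : (|C| + 1) * ‖x - j y‖ < ε / 2 := by
    rw [dist_eq_norm, lt_div_iff₀ (by positivity)] at hy
    linarith
  calc ‖u i x‖ = ‖u i (x - j y) + u i (j y)‖ := by rw [map_sub, sub_add_cancel]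
    _ ≤ _ := norm_add_le _ _
    _ < ε := by linarith

set_option linter.unusedSectionVars false

variable {A X : Type*} [NonUnitalCStarAlgebra A] [PartialOrder A] [StarOrderedRing A]
  [NormedAddCommGroup X] [NormedSpace ℂ X] [SMul A X] [CStarModule A X] [CompleteSpace X]

theorem Adjointable.norm_le_of_dense {T : Adjointable A X} {s : Set X} (hs : Dense s) {c : ℝ}
    (hc : 0 ≤ c) (h : ∀ x ∈ s, ‖T x‖ ≤ c * ‖x‖) : ‖T‖ ≤ c := by
  refine ContinuousLinearMap.opNorm_le_bound _ hc fun x => ?_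
  have hcl : IsClosed {x : X | ‖T x‖ ≤ c * ‖x‖} :=
    isClosed_le (Adjointable.toCLM T).continuous.norm (by fun_prop)
  exact hcl.closure_subset_iff.2 h (hs x)

/-! ### Commutators of T with resolvents and with e^(ipD) -/

namespace IsSelfadjointRegular

variable {D : X →ₗ.[ℂ] X}

/-- The map `f ↦ f(D)` as a unital ⋆-homomorphism on `C_b(ℝ)`. -/
def applyHom (hD : IsSelfadjointRegular A D) : (ℝ →ᵇ ℂ) →⋆ₐ[ℂ] Adjointable A X where
  toFun := hD.applyFun
  map_one' := map_one hD.functionalCalculus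
  map_mul' f g := map_mul hD.functionalCalculus (f.compContinuous _) (g.compContinuous _)
  map_zero' := map_zero hD.functionalCalculus
  map_add' f g := map_add hD.functionalCalculus (f.compContinuous _) (g.compContinuous _)
  commutes' c := AlgHomClass.commutes hD.functionalCalculus c
  map_star' f := map_star hD.functionalCalculus (f.compContinuous _)

theorem norm_applyHom_le (hD : IsSelfadjointRegular A D) (f : ℝ →ᵇ ℂ) :
    ‖hD.applyHom f‖ ≤ ‖f‖ := NonUnitalStarAlgHom.norm_apply_le hD.applyHom f

/-- The calculus is pinned down only by its value on the Cayley function, so (1 - it)⁻¹ = i(t + i)⁻¹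
is rewritten on σ(D) as ½(1 - (t - i)(t + i)⁻¹). -/
theorem applyHom_resolventFun_one (hD : IsSelfadjointRegular A D) :
    hD.applyHom (resolventFun 1) = I • hD.res := by
  have e : (resolventFun 1).compContinuous ⟨fun t : spec D => (t : ℂ).re, by fun_prop⟩
      = (1 / 2 : ℂ) • (1 - hD.cayleyFun) := by
    ext z
    have hz : (((z : ℂ).re : ℝ) : ℂ) = z := Complex.ext (by simp) (by simp [hD.im_eq_zero z.2])
    have h0 := hD.add_I_ne_zero z.2
    change ((1 : ℂ) - I * (1 : ℝ) * (z : ℂ).re)⁻¹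
      = (1 / 2 : ℂ) * (1 - ((z : ℂ) - I) * ((z : ℂ) + I)⁻¹)
    have e1 : (1 : ℂ) - I * (1 : ℝ) * z = -I * (z + I) := by
      push_cast
      linear_combination Complex.I_sq
    rw [hz, e1, mul_inv, inv_neg, Complex.inv_I, neg_neg]
    field_simp
    ring
  change hD.functionalCalculus _ = _
  rw [e, _root_.map_smul, map_sub, map_one, functionalCalculus_cayleyFun, res, smul_smul]
  congr 1
  have := Complex.I_ne_zero
  field_simp

/-- Identifies the calculus value of (1 - ist)⁻¹ as a left inverse of 1 - isD. -/
theorem applyHom_resolventFun (hD : IsSelfadjointRegular A D) (s : ℝ) (x : D.domain) :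
    hD.applyHom (resolventFun s) ((x : X) - (I * s) • D x) = x := by
  -- As t is not bounded, the identity (1 - ist)⁻¹(1 - ist) = 1 is multiplied by (t + i)⁻¹ = -i(1 -
  -- it)⁻¹, with t(t + i)⁻¹ = 1 - (1 - it)⁻¹. Evaluated at (D + i)x, these two functions of D give x
  -- and Dx.
  have h1 : resolventFun s * (-I) • resolventFun 1 - (I * s) •
      (resolventFun s * (1 - resolventFun 1)) = (-I) • resolventFun 1 := by
    ext t
    have h0 := one_sub_I_mul_ne_zero s t
    have h0' := one_sub_I_mul_ne_zero 1 t
    change ((1 : ℂ) - I * s * t)⁻¹ * (-I * ((1 : ℂ) - I * (1 : ℝ) * t)⁻¹) - (I * s) *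
      (((1 : ℂ) - I * s * t)⁻¹ * (1 - ((1 : ℂ) - I * (1 : ℝ) * t)⁻¹))
        = -I * ((1 : ℂ) - I * (1 : ℝ) * t)⁻¹
    generalize hr : ((1 : ℂ) - I * (1 : ℝ) * t)⁻¹ = r
    have hr' : r * ((1 : ℂ) - I * (1 : ℝ) * t) = 1 := hr ▸ inv_mul_cancel₀ h0'
    rw [Complex.ofReal_one] at hr'
    field_simp
    linear_combination (s : ℂ) * hr'
  have h2 := congrArg hD.applyHom h1
  have hres : (-I) • hD.applyHom (resolventFun 1) = hD.res := by
    rw [applyHom_resolventFun_one, smul_smul]; simp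
  simp only [map_sub, map_mul, _root_.map_smul, map_one] at h2
  rw [hres, applyHom_resolventFun_one] at h2
  have h3 := congrArg (fun T : Adjointable A X => T (shift D (-I) x)) h2
  simp only [Adjointable.sub_apply, Adjointable.smul_apply, Adjointable.mul_apply,
    Adjointable.one_apply, hD.res_shift] at h3
  have e : shift D (-I) x - I • (x : X) = D x := by rw [shift_apply]; module
  rw [e] at h3
  rw [map_sub, _root_.map_smul]
  exact h3

/-- 1 - isD = -is(D - (is)⁻¹), and (is)⁻¹ is not real, hence not in σ(D). -/
theorem exists_sub_smul_eq (hD : IsSelfadjointRegular A D) (s : ℝ) (hs : s ≠ 0) (y : X) :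
    ∃ x : D.domain, (x : X) - (I * s) • D x = y := by
  have hc : I * (s : ℂ) ≠ 0 := mul_ne_zero Complex.I_ne_zero (by exact_mod_cast hs)
  have hz : (I * s)⁻¹ ∉ spec D := fun h => hs (by simpa using hD.im_eq_zero h)
  obtain ⟨x, hx⟩ := (not_not.1 hz).2 (-(I * s)⁻¹ • y)
  rw [shift_apply] at hx
  refine ⟨x, ?_⟩
  calc (x : X) - (I * s) • D x = -((I * s) • (D x - (I * s)⁻¹ • (x : X))) := by
        rw [smul_sub, smul_inv_smul₀ hc]; abel
    _ = y := by rw [hx, neg_smul, smul_neg, neg_neg, smul_inv_smul₀ hc]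

/-- Formally [R, T] = R (T(1 - isD) - (1 - isD)T) R = is R [D, T] R. Evaluating at y = (1 - isD)x
keeps all vectors in Dom(D), since Tx again lies there. -/
theorem resolvent_commutator (hD : IsSelfadjointRegular A D) {T : Adjointable A X}
    (hT : IsLipschitz D T) (s : ℝ) :
    hD.applyHom (resolventFun s) * T - T * hD.applyHom (resolventFun s) = (I * s) •
      (hD.applyHom (resolventFun s) * hT.derivation * hD.applyHom (resolventFun s)) := by
  -- For s = 0 the map 1 - isD is only the inclusion of Dom(D), which need not be onto X.
  by_cases hs : s = 0
  · have : resolventFun 0 = 1 := by ext t; simp [resolventFun_apply]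
    rw [hs, this, map_one]
    simp
  refine Adjointable.ext fun y => ?_
  obtain ⟨x, rfl⟩ := hD.exists_sub_smul_eq s hs y
  have h1 := hD.applyHom_resolventFun s x
  have h2 : hD.applyHom (resolventFun s) (T x - (I * s) • D ⟨T x, hT.map_mem x⟩) = T x :=
    hD.applyHom_resolventFun s ⟨T x, hT.map_mem x⟩
  simp only [Adjointable.sub_apply, Adjointable.smul_apply, Adjointable.mul_apply, h1,
    hT.derivation_apply]
  conv_lhs => rw [← h2]
  rw [← map_sub, ← _root_.map_smul]
  congr 1
  rw [map_sub, _root_.map_smul]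
  module

theorem norm_resolvent_commutator_le (hD : IsSelfadjointRegular A D) {T : Adjointable A X}
    (hT : IsLipschitz D T) (s : ℝ) :
    ‖hD.applyHom (resolventFun s) * T - T * hD.applyHom (resolventFun s)‖
      ≤ |s| * ‖hT.derivation‖ := by
  have h1 : ‖hD.applyHom (resolventFun s)‖ ≤ 1 :=
    (hD.norm_applyHom_le _).trans (by simpa using norm_resolventFun_pow_le s 1)
  rw [hD.resolvent_commutator hT, norm_smul, norm_mul, Complex.norm_I, one_mul, Complex.norm_real,
    Real.norm_eq_abs]
  gcongr
  calc _ ≤ ‖hD.applyHom (resolventFun s)‖ * ‖hT.derivation‖ * ‖hD.applyHom (resolventFun s)‖ :=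
        (norm_mul_le _ _).trans (by gcongr; exact norm_mul_le _ _)
    _ ≤ 1 * ‖hT.derivation‖ * 1 := by gcongr
    _ = _ := by ring

/-- `(1 - i(p/n)D)⁻ⁿ` converges strongly to `e^(ipD)`. -/
theorem tendsto_resolvent_pow (hD : IsSelfadjointRegular A D) (p : ℝ) (x : X) :
    Tendsto (fun n : ℕ => hD.applyHom (resolventFun (p / n) ^ n) x) atTop
      (𝓝 (hD.applyHom (expFun p) x)) := by
  rw [← tendsto_sub_nhds_zero_iff]
  -- The uniform estimate carries the factor (1 - it)⁻², so convergence is checked on the range of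
  -- its operator, which is -(D + i)⁻².
  have hj : DenseRange fun y => hD.applyHom (resolventFun 1 * resolventFun 1) y := by
    have e : ∀ y, hD.applyHom (resolventFun 1 * resolventFun 1) y = hD.res (hD.res (-y)) := by
      intro y
      rw [map_mul, applyHom_resolventFun_one, Adjointable.mul_apply, Adjointable.smul_apply,
        Adjointable.smul_apply, _root_.map_smul, smul_smul, Complex.I_mul_I, map_neg, map_neg]
      module
    simp_rw [e]
    have hc : Continuous hD.res := (Adjointable.toCLM hD.res).continuous
    exact (hD.denseRange_res.comp hD.denseRange_res hc).comp
      neg_surjective.denseRange (hc.comp hc)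
  refine (tendsto_zero_of_denseRange (C := 2) (u := fun n : ℕ => Adjointable.toCLM
    (hD.applyHom (resolventFun (p / n) ^ n - expFun p))) (fun n => ?_) hj (fun y => ?_) x).congr
      fun n => ?_
  · refine (hD.norm_applyHom_le _).trans ((norm_sub_le _ _).trans ?_)
    linarith [norm_resolventFun_pow_le (p / n) n, norm_expFun_le p]
  · have hl : Tendsto (fun n : ℕ => 3 * p ^ 2 / n * ‖y‖) atTop (𝓝 0) := by
      simpa using (tendsto_const_div_atTop_nhds_zero_nat (3 * p ^ 2)).mul_const ‖y‖
    refine squeeze_zero_norm' ?_ hl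
    filter_upwards [eventually_ne_atTop 0] with n hn
    rw [← Adjointable.mul_apply, ← map_mul]
    refine (Adjointable.le_opNorm _ _).trans ?_
    gcongr
    exact (hD.norm_applyHom_le _).trans (norm_resolventFun_pow_sub_expFun_mul_le p hn)
  · rw [map_sub, Adjointable.sub_apply]

/-- The commutators with the n-th powers of (1 - i(p/n)D)⁻¹ converge strongly and obey a bound
independent of n, which the limit inherits vector by vector. -/
theorem norm_exp_commutator_le (hD : IsSelfadjointRegular A D) {T : Adjointable A X}
    (hT : IsLipschitz D T) (p : ℝ) :
    ‖hD.applyHom (expFun p) * T - T * hD.applyHom (expFun p)‖ ≤ |p| * ‖hT.derivation‖ := by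
  refine ContinuousLinearMap.opNorm_le_bound _ (by positivity) fun x => ?_
  have hl := ((hD.tendsto_resolvent_pow p (T x)).sub
    (((Adjointable.toCLM T).continuous.tendsto _).comp (hD.tendsto_resolvent_pow p x))).norm
  refine le_of_tendsto hl ?_
  filter_upwards [eventually_ne_atTop 0] with n hn
  have h := norm_pow_commutator_le (fun k => by
    rw [← map_pow]
    exact (hD.norm_applyHom_le _).trans (norm_resolventFun_pow_le (p / n) k))
    (hD.norm_resolvent_commutator_le hT (p / n)) n
  rw [← map_pow] at h
  have e : (n : ℝ) * (|p / n| * ‖hT.derivation‖) = |p| * ‖hT.derivation‖ := by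
    have : (n : ℝ) ≠ 0 := by exact_mod_cast hn
    rw [abs_div, Nat.abs_cast]
    field_simp
  rw [e] at h
  exact (Adjointable.le_opNorm (hD.applyHom (resolventFun (p / n) ^ n) * T -
    T * hD.applyHom (resolventFun (p / n) ^ n)) x).trans (by gcongr)

/-- The map `f ↦ f(D) y` as a bounded linear map. -/
def applyCLM (hD : IsSelfadjointRegular A D) (y : X) : (ℝ →ᵇ ℂ) →L[ℂ] X :=
  LinearMap.mkContinuous
    { toFun f := hD.applyHom f y
      map_add' f g := by rw [map_add, Adjointable.add_apply]
      map_smul' c f := by rw [_root_.map_smul, Adjointable.smul_apply, RingHom.id_apply] } ‖y‖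
    fun f => by
      rw [mul_comm]
      refine (Adjointable.le_opNorm (hD.applyHom f) y).trans ?_
      gcongr
      exact hD.norm_applyHom_le f

/-- A vector x of Dom(D) is (1 - iD)⁻¹ applied to x - iDx. This supplies the regularising factor, so
that sup-norm identities for f · (1 - it)⁻¹ become identities for f(D)x. -/
theorem applyCLM_mul_resolventFun (hD : IsSelfadjointRegular A D) (f : ℝ →ᵇ ℂ) (x : D.domain) :
    hD.applyCLM ((x : X) - I • D x) (f * resolventFun 1) = hD.applyHom f x := by
  have h := hD.applyHom_resolventFun 1 x
  rw [Complex.ofReal_one, mul_one] at h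
  change hD.applyHom (f * resolventFun 1) _ = _
  rw [map_mul, Adjointable.mul_apply, h]

/-! ### The Fourier integral for f(D) and the commutator estimate -/

section Fourier

open MeasureTheory Real

theorem integrable_fourierTransform_smul_apply (hD : IsSelfadjointRegular A D) {f : ℝ → ℂ}
    (hF : Integrable (fourierTransform f)) (x : D.domain) :
    Integrable fun p => fourierTransform f p • hD.applyHom (expFun p) x := by
  simpa only [_root_.map_smul, applyCLM_mul_resolventFun] using
    (hD.applyCLM ((x : X) - I • D x)).integrable_comp (integrable_fourierTransform_smul hF)

/-- The image of the inversion formula in `C_b(ℝ)` under the bounded map g ↦ g(D)(x - iDx). -/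
theorem applyHom_eq_integral (hD : IsSelfadjointRegular A D) (f : ℝ →ᵇ ℂ)
    (hf : Integrable fun x => f x) (hF : Integrable (fourierTransform f)) (x : D.domain) :
    hD.applyHom f x = ((1 / √(2 * π) : ℝ) : ℂ) •
      ∫ p, fourierTransform f p • hD.applyHom (expFun p) x := by
  have h := (hD.applyCLM ((x : X) - I • D x)).integral_comp_comm
    (integrable_fourierTransform_smul hF)
  simp only [_root_.map_smul, applyCLM_mul_resolventFun] at h
  rw [h, ← _root_.map_smul, integral_fourierTransform_smul f hf hF, applyCLM_mul_resolventFun]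

theorem norm_applyFun_commutator_le (hD : IsSelfadjointRegular A D) (f : ℝ →ᵇ ℂ)
    (hf : Integrable fun x => f x)
    (hpf : Integrable fun p : ℝ => (p : ℂ) * fourierTransform f p)
    {T : Adjointable A X} (hT : IsLipschitz D T) :
    ‖hD.applyFun f * T - T * hD.applyFun f‖ ≤
      ‖hT.derivation‖ * (1 / √(2 * π)) * ∫ p : ℝ, ‖(p : ℂ) * fourierTransform f p‖ := by
  have hF := integrable_fourierTransform hf hpf
  have h0 : 0 ≤ ∫ p : ℝ, ‖(p : ℂ) * fourierTransform f p‖ :=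
    integral_nonneg fun p => norm_nonneg _
  refine Adjointable.norm_le_of_dense hD.dense_domain (by positivity) fun x hx => ?_
  have h1 := hD.applyHom_eq_integral f hf hF ⟨x, hx⟩
  have h2 := hD.applyHom_eq_integral f hf hF ⟨T x, hT.map_mem ⟨x, hx⟩⟩
  have i1 := hD.integrable_fourierTransform_smul_apply hF ⟨x, hx⟩
  have i2 := hD.integrable_fourierTransform_smul_apply hF ⟨T x, hT.map_mem ⟨x, hx⟩⟩
  -- The integral formula is available only on Dom(D); it applies to Tx because T preserves the
  -- domain.
  have key : (hD.applyFun f * T - T * hD.applyFun f) x = ((1 / √(2 * π) : ℝ) : ℂ) •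
      ∫ p, fourierTransform f p •
        (hD.applyHom (expFun p) * T - T * hD.applyHom (expFun p)) x := by
    change hD.applyHom f (T x) - T (hD.applyHom f x) = _
    rw [h1, h2, _root_.map_smul, ← (Adjointable.toCLM T).integral_comp_comm i1, ← smul_sub,
      ← integral_sub i2 ((Adjointable.toCLM T).integrable_comp i1)]
    simp only [_root_.map_smul, ← smul_sub]
    rfl
  have hb : ‖∫ p, fourierTransform f p •
      (hD.applyHom (expFun p) * T - T * hD.applyHom (expFun p)) x‖
        ≤ ∫ p : ℝ, ‖(p : ℂ) * fourierTransform f p‖ * (‖hT.derivation‖ * ‖x‖) := by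
    refine norm_integral_le_of_norm_le (hpf.norm.mul_const _) (.of_forall fun p => ?_)
    rw [norm_smul, norm_mul, Complex.norm_real, Real.norm_eq_abs]
    calc _ ≤ ‖fourierTransform f p‖ * (|p| * ‖hT.derivation‖ * ‖x‖) := by
          gcongr
          refine (Adjointable.le_opNorm
            (hD.applyHom (expFun p) * T - T * hD.applyHom (expFun p)) x).trans ?_
          gcongr
          exact hD.norm_exp_commutator_le hT p
      _ = _ := by ring
  rw [integral_mul_const] at hb
  rw [key, norm_smul, Complex.norm_real, Real.norm_of_nonneg (by positivity)]
  calc _ ≤ 1 / √(2 * π) * ((∫ p : ℝ, ‖(p : ℂ) * fourierTransform f p‖) *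
        (‖hT.derivation‖ * ‖x‖)) := by gcongr
    _ = _ := by ring

end Fourier

end IsSelfadjointRegular

/-! ### Rescaling D -/

theorem IsLipschitz.derivation_eq {D : X →ₗ.[ℂ] X} (hd : Dense (D.domain : Set X))
    {T : Adjointable A X} (hT : IsLipschitz D T) {S : Adjointable A X}
    (hS : ∀ x : D.domain, S x = D ⟨T x, hT.map_mem x⟩ - T (D x)) : hT.derivation = S :=
  Adjointable.ext fun x => congrFun (Continuous.ext_on hd
    (Adjointable.toCLM hT.derivation).continuous (Adjointable.toCLM S).continuous fun y hy =>
      (hT.derivation_apply ⟨y, hy⟩).trans (hS ⟨y, hy⟩).symm) x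

theorem IsLipschitz.smul_derivation_apply {D : X →ₗ.[ℂ] X} {T : Adjointable A X}
    (hT : IsLipschitz D T) (c : ℂ) (x : D.domain) :
    (c • hT.derivation) x = (c • D) ⟨T x, hT.map_mem x⟩ - T ((c • D) x) := by
  rw [Adjointable.smul_apply, hT.derivation_apply, LinearPMap.smul_apply, LinearPMap.smul_apply,
    smul_sub, _root_.map_smul]

theorem IsLipschitz.smul {D : X →ₗ.[ℂ] X} {T : Adjointable A X} (hT : IsLipschitz D T) (c : ℂ) :
    IsLipschitz (c • D) T :=
  ⟨hT.map_mem, c • hT.derivation, hT.smul_derivation_apply c⟩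

/-- The two derivations are independently chosen extensions; density of the domain forces them to
agree up to the scalar. -/
theorem IsLipschitz.derivation_smul {D : X →ₗ.[ℂ] X} (hd : Dense (D.domain : Set X))
    {T : Adjointable A X} (hT : IsLipschitz D T) (c : ℂ) :
    (hT.smul c).derivation = c • hT.derivation :=
  (hT.smul c).derivation_eq (D := c • D) hd (hT.smul_derivation_apply c)

end HilbertModule
end

theorem propositionp {A X : Type*} [NonUnitalCStarAlgebra A] [PartialOrder A] [StarOrderedRing A]
    [NormedAddCommGroup X] [NormedSpace ℂ X] [CompleteSpace X] [SMul Aᵐᵒᵖ X] [CStarModule Aᵐᵒᵖ X]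
    (D : X →ₗ.[ℂ] X) (hD : HilbertModule.IsSelfadjointRegular Aᵐᵒᵖ D)
    (f : ℝ →ᵇ ℂ) (hf : MeasureTheory.Integrable (fun x : ℝ => f x))
    (hpf : MeasureTheory.Integrable
      (fun p : ℝ => (p : ℂ) * HilbertModule.fourierTransform f p))
    (T : HilbertModule.Adjointable Aᵐᵒᵖ X) (hT : HilbertModule.IsLipschitz D T) :
    ‖hD.applyFun f * T - T * hD.applyFun f‖ ≤
        ‖hT.derivation‖ * (1 / √(2 * Real.pi)) *
          ∫ p : ℝ, ‖(p : ℂ) * HilbertModule.fourierTransform f p‖ ∧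
      ∀ (ρ : ℝ) (hρ : 0 < ρ),
        ‖(hD.inv_smul hρ).applyFun f * T - T * (hD.inv_smul hρ).applyFun f‖ ≤
          1 / (ρ * √(2 * Real.pi)) * ‖hT.derivation‖ *
            ∫ p : ℝ, ‖(p : ℂ) * HilbertModule.fourierTransform f p‖ := by
  refine ⟨hD.norm_applyFun_commutator_le f hf hpf hT, fun ρ hρ => ?_⟩
  -- The first inequality for ρ⁻¹D with the same f; the factor 1/ρ comes only from the norm of the
  -- rescaled derivation.
  refine ((hD.inv_smul hρ).norm_applyFun_commutator_le f hf hpf (hT.smul _)).trans_eq ?_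
  rw [hT.derivation_smul hD.dense_domain, norm_smul, norm_inv, Complex.norm_real,
    Real.norm_of_nonneg hρ.le]
  have : √(2 * Real.pi) ≠ 0 := by positivity
  field_simp
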